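/- Let $R=\bigoplus_{n\ge 0}R_n$ be a commutative graded ring such that $R_0$ is Noetherian and $R$ is a finitely generated standard graded $R_0$-algebra (that is, $R$ is generated over $R_0$ by finitely many elements of $R_1$). Put $R_+=\bigoplus_{n>0}R_n$. Let $M=\bigoplus_{n\in\mathbb Z}M_n$ be a finitely generated graded $R$-module. For a graded $R$-module $N$ let $\Gamma_{R_+}(N)=\{e\in N \mid R_te=0 \text{ for } t\gg 0\}$, and let $H^i_{R_+}$ ($i\ge 0$) be the $i$-th right derived functor of $\Gamma_{R_+}$ on the category of graded $R$-modules; thus $H^i_{R_+}(M)$ is a graded $R$-module. Let $d(M)$ denote the maximal degree of an element of a minimal set of homogeneous generators of $M$ (with $d(M)=-\infty$ if $M=0$). For a graded module $H$ put $a(H)=\sup\{n \mid H_n\neq 0\}$ (with $a(0)=-\infty$), and put $\operatorname{reg}(M)=\sup\{a(H^i_{R_+}(M))+i \mid i\ge 0\}$. For an integer $t$, $M$ is called $t$-regular if $H^i_{R_+}(M)_{n-i+1}=0$ for all $i\ge 0$ and all $n\ge t$, and weakly $t$-regular if $H^i_{R_+}(M)_{t-i+1}=0$ for all $i\ge 0$.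 (a) If $t\ge d(M)$ is an integer and $M$ is weakly $t$-regular, then $M$ is $t$-regular. (b) If $M\neq 0$, then $\operatorname{reg}(M)$ is an integer, and $$\operatorname{reg}(M)=\min\{t\in\mathbb Z \mid t\ge d(M) \text{ and } M \text{ is weakly } t\text{-regular}\}.$$ -/

import Mathlib

open CategoryTheory CategoryTheory.Limits

universe u

noncomputable section

/-! ## The category of `ℤ`-graded modules over an `ℕ`-graded ring -/

/-- A `ℤ`-graded module `⨁ X n` over the graded ring `R = ⨁ 𝒜 m`, given by its homogeneous
components and the multiplications `𝒜 m × X n → X (m + n)`.  The target index is a variable `k`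
with a proof of `m + n = k`, which avoids transports along equalities of degrees. -/
structure GrMod {R : Type u} [CommRing R] (𝒜 : ℕ → AddSubgroup R) [GradedRing 𝒜] where
  /-- the homogeneous component of degree `n` -/
  X : ℤ → Type u
  [grp : ∀ n, AddCommGroup (X n)]
  /-- multiplication by homogeneous elements of degree `m` -/
  act : ∀ (m : ℕ) (n k : ℤ), (m : ℤ) + n = k → 𝒜 m →+ X n →+ X k
  one_act : ∀ (n : ℤ) (h : ((0 : ℕ) : ℤ) + n = n) (x : X n),
    act 0 n n h ⟨1, SetLike.GradedOne.one_mem⟩ x = x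
  mul_act : ∀ (a b : ℕ) (n m k : ℤ) (hb : (b : ℤ) + n = m) (ha : (a : ℤ) + m = k)
    (hab : ((a + b : ℕ) : ℤ) + n = k) (r : 𝒜 a) (s : 𝒜 b) (x : X n),
    act (a + b) n k hab ⟨(r : R) * s, SetLike.GradedMul.mul_mem r.2 s.2⟩ x
      = act a m k ha r (act b n m hb s x)

namespace GrMod

attribute [instance] GrMod.grp

variable {R : Type u} [CommRing R] {𝒜 : ℕ → AddSubgroup R} [GradedRing 𝒜]

/-- Homogeneous homomorphisms of degree zero. -/
@[ext]
structure Hom (X Y : GrMod 𝒜) where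
  /-- the component in degree `n` -/
  app : ∀ n, X.X n →+ Y.X n
  comm : ∀ (m : ℕ) (n k : ℤ) (h : (m : ℤ) + n = k) (r : 𝒜 m) (x : X.X n),
    app k (X.act m n k h r x) = Y.act m n k h r (app n x)

instance : Category (GrMod 𝒜) where
  Hom X Y := Hom X Y
  id X := { app := fun n => AddMonoidHom.id (X.X n), comm := fun _ _ _ _ _ _ => rfl }
  comp f g :=
    { app := fun n => (g.app n).comp (f.app n)
      comm := fun m n k h r x => by simp [f.comm, g.comm] }

@[ext]
lemma hom_ext {X Y : GrMod 𝒜} {f g : X ⟶ Y} (h : ∀ n x, f.app n x = g.app n x) : f = g :=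
  Hom.ext (funext fun n => AddMonoidHom.ext (h n))

@[simp] lemma id_app (X : GrMod 𝒜) (n : ℤ) (x : X.X n) : Hom.app (𝟙 X) n x = x := rfl

@[simp] lemma comp_app {X Y Z : GrMod 𝒜} (f : X ⟶ Y) (g : Y ⟶ Z) (n : ℤ) (x : X.X n) :
    Hom.app (f ≫ g) n x = g.app n (f.app n x) := rfl

instance (X Y : GrMod 𝒜) : Zero (X ⟶ Y) :=
  ⟨{ app := fun _ => 0, comm := fun _ _ _ _ _ _ => by simp }⟩
instance (X Y : GrMod 𝒜) : Add (X ⟶ Y) :=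
  ⟨fun f g => { app := fun n => f.app n + g.app n, comm := fun _ _ _ _ _ _ => by simp [Hom.comm] }⟩
instance (X Y : GrMod 𝒜) : Neg (X ⟶ Y) :=
  ⟨fun f => { app := fun n => - f.app n, comm := fun _ _ _ _ _ _ => by simp [Hom.comm] }⟩

@[simp] lemma zero_app (X Y : GrMod 𝒜) (n : ℤ) (x : X.X n) :
    Hom.app (0 : X ⟶ Y) n x = 0 := rfl
@[simp] lemma add_app {X Y : GrMod 𝒜} (f g : X ⟶ Y) (n : ℤ) (x : X.X n) :
    Hom.app (f + g) n x = f.app n x + g.app n x := rfl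
@[simp] lemma neg_app {X Y : GrMod 𝒜} (f : X ⟶ Y) (n : ℤ) (x : X.X n) :
    Hom.app (-f) n x = - f.app n x := rfl

instance (X Y : GrMod 𝒜) : AddCommGroup (X ⟶ Y) where
  add_assoc f g h := by ext; simp [add_assoc]
  zero_add f := by ext; simp
  add_zero f := by ext; simp
  add_comm f g := by ext; simp [add_comm]
  neg_add_cancel f := by ext; simp
  nsmul := nsmulRec
  zsmul := zsmulRec

instance : Preadditive (GrMod 𝒜) where
  add_comp _ _ _ _ _ _ := by ext; simp
  comp_add _ _ _ _ _ _ := by ext; simp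

/-- The zero module. -/
def zeroObj : GrMod 𝒜 where
  X _ := PUnit
  act _ _ _ _ := 0
  one_act _ _ _ := rfl
  mul_act _ _ _ _ _ _ _ _ _ _ _ := rfl

instance : HasZeroObject (GrMod 𝒜) :=
  ⟨⟨zeroObj, (IsZero.iff_id_eq_zero _).2 (by ext; rfl)⟩⟩

/-- The direct sum of two graded modules. -/
def prod (X Y : GrMod 𝒜) : GrMod 𝒜 where
  X n := X.X n × Y.X n
  act m n k h :=
    AddMonoidHom.mk' (fun r => (X.act m n k h r).prodMap (Y.act m n k h r))
      (fun r s => by ext <;> simp)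
  one_act n h x := by ext <;> simp [X.one_act, Y.one_act]
  mul_act a b n m k hb ha hab r s x := by
    ext <;> simp [X.mul_act a b n m k hb ha, Y.mul_act a b n m k hb ha]

/-- The direct sum as a biproduct diagram. -/
def prodBicone (X Y : GrMod 𝒜) : BinaryBicone X Y where
  pt := prod X Y
  fst := { app := fun _ => AddMonoidHom.fst _ _, comm := fun _ _ _ _ _ _ => rfl }
  snd := { app := fun _ => AddMonoidHom.snd _ _, comm := fun _ _ _ _ _ _ => rfl }
  inl :=
    { app := fun _ => AddMonoidHom.inl _ _
      comm := fun m n k h r _ => Prod.ext rfl (map_zero (Y.act m n k h r)).symm }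
  inr :=
    { app := fun _ => AddMonoidHom.inr _ _
      comm := fun m n k h r _ => Prod.ext (map_zero (X.act m n k h r)).symm rfl }
  inl_fst := rfl
  inl_snd := rfl
  inr_fst := rfl
  inr_snd := rfl

instance : HasBinaryBiproducts (GrMod 𝒜) where
  has_binary_biproduct X Y := hasBinaryBiproduct_of_total (prodBicone X Y) (by
    ext n x
    exact Prod.ext (add_zero (Prod.fst (α := X.X n) (β := Y.X n) x))
      (zero_add (Prod.snd (α := X.X n) (β := Y.X n) x)))

instance : HasFiniteProducts (GrMod 𝒜) := hasFiniteProducts_of_has_binary_and_terminal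

/-! ### Graded submodules and quotients -/

/-- A family of subgroups of the components is a graded submodule. -/
def IsSub (X : GrMod 𝒜) (N : ∀ n, AddSubgroup (X.X n)) : Prop :=
  ∀ (m : ℕ) (n k : ℤ) (h : (m : ℤ) + n = k) (r : 𝒜 m) (x : X.X n),
    x ∈ N n → X.act m n k h r x ∈ N k

/-- A graded submodule as a graded module. -/
def sub (X : GrMod 𝒜) (N : ∀ n, AddSubgroup (X.X n)) (hN : X.IsSub N) : GrMod 𝒜 where
  X n := N n
  act m n k h :=
    AddMonoidHom.mk'
      (fun r => ((X.act m n k h r).comp (N n).subtype).codRestrict (N k)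
        (fun x => hN m n k h r x x.2))
      (fun r s => by
        ext x
        exact DFunLike.congr_fun (map_add (X.act m n k h) r s) (x : X.X n))
  one_act n h x := Subtype.ext (X.one_act n h x)
  mul_act a b n m k hb ha hab r s x := Subtype.ext (X.mul_act a b n m k hb ha hab r s x)

/-- The inclusion of a graded submodule. -/
def subι (X : GrMod 𝒜) (N : ∀ n, AddSubgroup (X.X n)) (hN : X.IsSub N) : X.sub N hN ⟶ X where
  app n := (N n).subtype
  comm _ _ _ _ _ _ := rfl

/-- A homomorphism with values in a graded submodule factors through it. -/
def subLift {X Y : GrMod 𝒜} (N : ∀ n, AddSubgroup (X.X n)) (hN : X.IsSub N) (f : Y ⟶ X)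
    (hf : ∀ n y, f.app n y ∈ N n) : Y ⟶ X.sub N hN where
  app n := (f.app n).codRestrict (N n) (hf n)
  comm m n k h r x := Subtype.ext (f.comm m n k h r x)

/-- The quotient by a graded submodule. -/
def quot (X : GrMod 𝒜) (N : ∀ n, AddSubgroup (X.X n)) (hN : X.IsSub N) : GrMod 𝒜 where
  X n := X.X n ⧸ N n
  act m n k h :=
    AddMonoidHom.mk'
      (fun r => QuotientAddGroup.map (N n) (N k) (X.act m n k h r) (fun x hx => hN m n k h r x hx))
      (fun r s => by
        ext x
        exact congrArg (QuotientAddGroup.mk' (N k))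
          (DFunLike.congr_fun (map_add (X.act m n k h) r s) x))
  one_act n h x := by
    induction x using QuotientAddGroup.induction_on with
    | H x => exact congrArg (QuotientAddGroup.mk' (N n)) (X.one_act n h x)
  mul_act a b n m k hb ha hab r s x := by
    induction x using QuotientAddGroup.induction_on with
    | H x => exact congrArg (QuotientAddGroup.mk' (N k)) (X.mul_act a b n m k hb ha hab r s x)

/-- The projection onto the quotient by a graded submodule. -/
def quotπ (X : GrMod 𝒜) (N : ∀ n, AddSubgroup (X.X n)) (hN : X.IsSub N) : X ⟶ X.quot N hN where
  app n := QuotientAddGroup.mk' (N n)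
  comm _ _ _ _ _ _ := rfl

/-- A homomorphism vanishing on a graded submodule factors through the quotient. -/
def quotDesc {X Y : GrMod 𝒜} (N : ∀ n, AddSubgroup (X.X n)) (hN : X.IsSub N) (f : X ⟶ Y)
    (hf : ∀ n, ∀ x ∈ N n, f.app n x = 0) : X.quot N hN ⟶ Y where
  app n := QuotientAddGroup.lift (N n) (f.app n) (fun x hx => hf n x hx)
  comm m n k h r x := by
    induction x using QuotientAddGroup.induction_on with
    | H x => exact f.comm m n k h r x

lemma isSub_ker {X Y : GrMod 𝒜} (f : X ⟶ Y) : X.IsSub (fun n => (f.app n).ker) := by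
  intro m n k h r x hx
  rw [AddMonoidHom.mem_ker] at hx ⊢
  rw [f.comm, hx, map_zero]

lemma isSub_range {X Y : GrMod 𝒜} (f : X ⟶ Y) : Y.IsSub (fun n => (f.app n).range) := by
  rintro m n k h r _ ⟨x, rfl⟩
  exact ⟨X.act m n k h r x, f.comm m n k h r x⟩

lemma subι_comp {X Y : GrMod 𝒜} (f : X ⟶ Y) : subι X _ (isSub_ker f) ≫ f = 0 := by
  ext n x
  exact Subtype.prop (p := fun x => x ∈ (f.app n).ker) x

lemma comp_quotπ {X Y : GrMod 𝒜} (f : X ⟶ Y) : f ≫ quotπ Y _ (isSub_range f) = 0 := by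
  ext n x
  exact (QuotientAddGroup.eq_zero_iff (N := (f.app n).range) _).2 (AddMonoidHom.mem_range.2 ⟨x, rfl⟩)

/-- The kernel of a homomorphism. -/
def kerFork {X Y : GrMod 𝒜} (f : X ⟶ Y) : KernelFork f :=
  KernelFork.ofι (subι X _ (isSub_ker f)) (subι_comp f)

/-- The universal property of the kernel. -/
def kerForkIsLimit {X Y : GrMod 𝒜} (f : X ⟶ Y) : IsLimit (kerFork f) :=
  KernelFork.IsLimit.ofι _ (subι_comp f)
    (fun g hg => subLift _ (isSub_ker f) g (fun n y => by
      have := congrArg (fun φ => Hom.app φ n y) hg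
      exact this))
    (fun g hg => rfl)
    (fun g hg m hm => by
      ext n y
      exact Subtype.ext (congrArg (fun φ => Hom.app φ n y) hm))

instance : HasKernels (GrMod 𝒜) where
  has_limit f := ⟨⟨kerFork f, kerForkIsLimit f⟩⟩

/-- The cokernel of a homomorphism. -/
def cokerCofork {X Y : GrMod 𝒜} (f : X ⟶ Y) : CokernelCofork f :=
  CokernelCofork.ofπ (quotπ Y _ (isSub_range f)) (comp_quotπ f)

/-- The universal property of the cokernel. -/
def cokerCoforkIsColimit {X Y : GrMod 𝒜} (f : X ⟶ Y) : IsColimit (cokerCofork f) :=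
  CokernelCofork.IsColimit.ofπ _ (comp_quotπ f)
    (fun g hg => quotDesc _ (isSub_range f) g (by
      rintro n _ ⟨x, rfl⟩
      exact congrArg (fun φ => Hom.app φ n x) hg))
    (fun g hg => rfl)
    (fun g hg m hm => by
      ext n y
      induction y using QuotientAddGroup.induction_on with
      | H y => exact congrArg (fun φ => Hom.app φ n y) hm)

instance : HasCokernels (GrMod 𝒜) where
  has_colimit f := ⟨⟨cokerCofork f, cokerCoforkIsColimit f⟩⟩

lemma injective_of_mono {X Y : GrMod 𝒜} (f : X ⟶ Y) [Mono f] (n : ℤ) :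
    Function.Injective (f.app n) := by
  rw [injective_iff_map_eq_zero]
  intro x hx
  have h0 : subι X _ (isSub_ker f) = 0 := by
    rw [← cancel_mono f, zero_comp]
    exact subι_comp f
  exact congrArg (fun φ : X.sub _ (isSub_ker f) ⟶ X => φ.app n (⟨x, hx⟩ : (f.app n).ker)) h0

lemma surjective_of_epi {X Y : GrMod 𝒜} (f : X ⟶ Y) [Epi f] (n : ℤ) :
    Function.Surjective (f.app n) := by
  intro y
  have h0 : quotπ Y _ (isSub_range f) = 0 := by
    rw [← cancel_epi f, comp_zero]
    exact comp_quotπ f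
  exact (QuotientAddGroup.eq_zero_iff y).1 (congrArg (fun φ => Hom.app φ n y) h0)

/-- A homomorphism with values in the image of an injective homomorphism factors through it. -/
def liftOfInjective {X Y Z : GrMod 𝒜} (f : X ⟶ Y) (hf : ∀ n, Function.Injective (f.app n))
    (g : Z ⟶ Y) (hg : ∀ n z, ∃ x, f.app n x = g.app n z) : Z ⟶ X where
  app n := AddMonoidHom.mk' (fun z => (hg n z).choose) (fun a b => hf n
    ((hg n (a + b)).choose_spec.trans (((map_add (g.app n) a b).trans
      (congrArg₂ (· + ·) (hg n a).choose_spec (hg n b).choose_spec).symm).trans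
        (map_add (f.app n) _ _).symm)))
  comm m n k h r z := hf k (by
    rw [f.comm]
    simp only [AddMonoidHom.mk'_apply]
    exact (hg k _).choose_spec.trans ((g.comm m n k h r z).trans
      (congrArg (Y.act m n k h r) (hg n z).choose_spec).symm))

/-- A homomorphism that vanishes on the kernel of a surjective homomorphism factors through it. -/
def descOfSurjective {X Y Z : GrMod 𝒜} (f : X ⟶ Y) (hf : ∀ n, Function.Surjective (f.app n))
    (g : X ⟶ Z) (hg : ∀ n x, f.app n x = 0 → g.app n x = 0) : Y ⟶ Z :=
  have key : ∀ n x x', f.app n x = f.app n x' → g.app n x = g.app n x' := fun n x x' h => by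
    rw [← sub_eq_zero, ← map_sub] at h ⊢
    exact hg n _ h
  { app := fun n => AddMonoidHom.mk' (fun y => g.app n (hf n y).choose) (fun a b => by
      rw [← map_add]
      apply key
      rw [map_add, (hf n (a + b)).choose_spec, (hf n a).choose_spec, (hf n b).choose_spec])
    comm := fun m n k h r y => by
      simp only [AddMonoidHom.mk'_apply]
      rw [← g.comm]
      apply key
      rw [f.comm, (hf k _).choose_spec, (hf n y).choose_spec] }

instance : IsNormalMonoCategory (GrMod 𝒜) where
  normalMonoOfMono {X Y} f _ :=
    have key : ∀ {Z : GrMod 𝒜} (g : Z ⟶ Y) (hg : g ≫ quotπ Y _ (isSub_range f) = 0) (n : ℤ)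
        (z : Z.X n), ∃ x, f.app n x = g.app n z := fun g hg n z =>
      (QuotientAddGroup.eq_zero_iff (N := (f.app n).range) _).1
        (congrArg (fun φ => Hom.app φ n z) hg)
    have fac : ∀ {Z : GrMod 𝒜} (g : Z ⟶ Y) (hg : g ≫ quotπ Y _ (isSub_range f) = 0),
        liftOfInjective f (injective_of_mono f) g (key g hg) ≫ f = g := fun g hg => by
      ext n z
      exact (key g hg n z).choose_spec
    ⟨{ Z := _
       g := quotπ Y _ (isSub_range f)
       w := comp_quotπ f
       isLimit := KernelFork.IsLimit.ofι _ _
        (fun g hg => liftOfInjective f (injective_of_mono f) g (key g hg))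
        (fun g hg => fac g hg)
        (fun g hg m hm => by rw [← cancel_mono f, hm, fac g hg]) }⟩

instance : IsNormalEpiCategory (GrMod 𝒜) where
  normalEpiOfEpi {X Y} f _ :=
    have key : ∀ {Z : GrMod 𝒜} (g : X ⟶ Z) (hg : subι X _ (isSub_ker f) ≫ g = 0) (n : ℤ)
        (x : X.X n), f.app n x = 0 → g.app n x = 0 := fun g hg n x hx =>
      congrArg (fun φ : X.sub _ (isSub_ker f) ⟶ _ => φ.app n (⟨x, hx⟩ : (f.app n).ker)) hg
    have fac : ∀ {Z : GrMod 𝒜} (g : X ⟶ Z) (hg : subι X _ (isSub_ker f) ≫ g = 0),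
        f ≫ descOfSurjective f (surjective_of_epi f) g (key g hg) = g := fun g hg => by
      ext n x
      rw [← sub_eq_zero]
      change g.app n (surjective_of_epi f n (f.app n x)).choose - _ = 0
      rw [← map_sub]
      apply key g hg
      rw [map_sub, (surjective_of_epi f n (f.app n x)).choose_spec, sub_self]
    ⟨{ W := _
       g := subι X _ (isSub_ker f)
       w := subι_comp f
       isColimit := CokernelCofork.IsColimit.ofπ _ _
        (fun g hg => descOfSurjective f (surjective_of_epi f) g (key g hg))
        (fun g hg => fac g hg)
        (fun g hg m hm => by rw [← cancel_epi f, hm, fac g hg]) }⟩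

instance : Abelian (GrMod 𝒜) where

/-! ### Enough injectives -/

/-- The pairs `(m, n)` with `m + k = n`. -/
abbrev Idx (k : ℤ) : Type := {p : ℕ × ℤ // (p.1 : ℤ) + k = p.2}

lemma idx_congr {R : Type u} [CommRing R] {𝒜 : ℕ → AddSubgroup R} {G : ℤ → Type u} [∀ n, AddCommGroup (G n)] {k n : ℤ}
    (φ : ∀ p : Idx k, 𝒜 p.1.1 →+ G p.1.2) {d e : ℕ} (hde : d = e) (h1 : (d : ℤ) + k = n)
    (h2 : (e : ℤ) + k = n) (x : 𝒜 d) (y : 𝒜 e) (hxy : (x : R) = y) :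
    φ ⟨(d, n), h1⟩ x = φ ⟨(e, n), h2⟩ y := by
  subst hde
  obtain rfl : x = y := Subtype.ext hxy
  rfl

/-- The coinduced graded module on a family `G` of abelian groups: its component of degree `k` is
the product of the groups `Hom(𝒜 m, G n)` over all `m`, `n` with `m + k = n`. -/
def coind (𝒜 : ℕ → AddSubgroup R) [GradedRing 𝒜] (G : ℤ → Type u) [∀ n, AddCommGroup (G n)] :
    GrMod 𝒜 where
  X k := ∀ p : Idx k, 𝒜 p.1.1 →+ G p.1.2
  act a k l h :=
    AddMonoidHom.mk'
      (fun r => AddMonoidHom.mk'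
        (fun φ p => AddMonoidHom.mk'
          (fun s => φ ⟨(p.1.1 + a, p.1.2), by have := p.2; push_cast; omega⟩
            ⟨(s : R) * r, SetLike.GradedMul.mul_mem s.2 r.2⟩)
          (fun s s' => by
            rw [← map_add]; congr 1; exact Subtype.ext (add_mul (s : R) s' r)))
        (fun φ ψ => by funext p; ext s; rfl))
      (fun r r' => by
        refine AddMonoidHom.ext (fun φ => funext (fun p => AddMonoidHom.ext (fun s => ?_)))
        change φ _ _ = φ _ _ + φ _ _
        rw [← map_add]; congr 1; exact Subtype.ext (mul_add (s : R) r r'))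
  one_act k h φ := by
    funext ⟨⟨m, n⟩, hm⟩
    ext s
    exact idx_congr φ (add_zero m) _ _ _ _ (mul_one (s : R))
  mul_act a b n m k hb ha hab r s φ := by
    funext ⟨⟨c, l⟩, hl⟩
    ext t
    exact idx_congr φ (add_assoc c a b).symm _ _ _ _ (mul_assoc (t : R) r s).symm

/-- The homomorphism into a coinduced module determined by a family of additive maps. -/
def coindLift {X : GrMod 𝒜} (G : ℤ → Type u) [∀ n, AddCommGroup (G n)]
    (φ : ∀ n, X.X n →+ G n) : X ⟶ coind 𝒜 G where
  app k := show X.X k →+ ∀ p : Idx k, 𝒜 p.1.1 →+ G p.1.2 from AddMonoidHom.mk'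
    (fun x p => (φ p.1.2).comp ((X.act p.1.1 k p.1.2 p.2).flip x))
    (fun x y => by funext p; ext s; simp)
  comm a k l h r x := by
    refine funext (fun p : Idx l => ?_)
    obtain ⟨⟨m, n⟩, hm⟩ := p
    refine AddMonoidHom.ext (fun s => ?_)
    change φ n (X.act m l n hm s (X.act a k l h r x)) = φ n (X.act (m + a) k n _ _ x)
    rw [X.mul_act m a k l n h hm]

/-- Evaluation at the unit element. -/
def coindEval {X : GrMod 𝒜} (G : ℤ → Type u) [∀ n, AddCommGroup (G n)]
    (f : X ⟶ coind 𝒜 G) (n : ℤ) : X.X n →+ G n :=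
  AddMonoidHom.mk'
    (fun x => (show ∀ p : Idx n, 𝒜 p.1.1 →+ G p.1.2 from f.app n x) ⟨(0, n), by simp⟩
      ⟨1, SetLike.GradedOne.one_mem⟩)
    (fun x y => by rw [map_add]; rfl)

lemma coindLift_eval {X : GrMod 𝒜} (G : ℤ → Type u) [∀ n, AddCommGroup (G n)]
    (f : X ⟶ coind 𝒜 G) : coindLift G (coindEval G f) = f := by
  ext k x
  refine funext (fun p : Idx k => ?_)
  obtain ⟨⟨m, n⟩, h⟩ := p
  refine AddMonoidHom.ext (fun s => ?_)
  change (show ∀ p : Idx n, 𝒜 p.1.1 →+ G p.1.2 from f.app n (X.act m k n h s x))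
    ⟨(0, n), _⟩ ⟨1, _⟩ = _
  rw [f.comm]
  exact idx_congr (f.app k x) (zero_add m) _ _ _ _ (one_mul (s : R))

lemma coind_injective (G : ℤ → Type u) [∀ n, AddCommGroup (G n)]
    (hG : ∀ n, Injective (AddCommGrpCat.of (G n))) : Injective (coind 𝒜 G) where
  factors {X Y} g f _ := by
    have hm : ∀ n, Mono (AddCommGrpCat.ofHom (f.app n)) := fun n =>
      (AddCommGrpCat.mono_iff_injective _).2 (injective_of_mono f n)
    choose ψ hψ using fun n => (hG n).factors (AddCommGrpCat.ofHom (coindEval G g n))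
      (AddCommGrpCat.ofHom (f.app n))
    refine ⟨coindLift G (fun n => (ψ n).hom), ?_⟩
    rw [← coindLift_eval G g]
    ext k x
    refine funext (fun p : Idx k => ?_)
    obtain ⟨⟨m, n⟩, h⟩ := p
    refine AddMonoidHom.ext (fun s => ?_)
    change (ψ n).hom (Y.act m k n h s (f.app k x)) = coindEval G g n (X.act m k n h s x)
    rw [← f.comm]
    exact ConcreteCategory.congr_hom (hψ n) _

instance : EnoughInjectives (GrMod 𝒜) where
  presentation X := by
    let G : ℤ → AddCommGrpCat.{u} := fun n => Injective.under (AddCommGrpCat.of (X.X n))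
    let j : ∀ n, X.X n →+ G n := fun n => (Injective.ι (AddCommGrpCat.of (X.X n))).hom
    have hj : ∀ n, Function.Injective (j n) := fun n =>
      (AddCommGrpCat.mono_iff_injective (Injective.ι (AddCommGrpCat.of (X.X n)))).1 inferInstance
    refine ⟨{ J := coind 𝒜 (fun n => G n)
              injective := coind_injective _ (fun n => ?_)
              f := coindLift _ j
              mono := ⟨fun {Z} g g' h => ?_⟩ }⟩
    · exact inferInstanceAs (Injective (Injective.under (AddCommGrpCat.of (X.X n))))
    · ext n z
      apply hj n
      have h1 := congrArg (fun φ => coindEval _ φ n z) h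
      have h2 : ∀ x : X.X n, coindEval (fun n => G n) (coindLift _ j) n x = j n x := fun x =>
        congrArg (j n) (X.one_act n (by simp) x)
      exact (h2 _).symm.trans (h1.trans (h2 _))

/-! ## Local cohomology -/

/-- The component of degree `n` of `Γ_{R₊}(X)`: the elements killed by `R_t` for all `t ≫ 0`. -/
def torsion (X : GrMod 𝒜) (n : ℤ) : AddSubgroup (X.X n) where
  carrier := {x | ∃ t₀ : ℕ, ∀ (t : ℕ), t₀ ≤ t → ∀ (k : ℤ) (h : (t : ℤ) + n = k) (r : 𝒜 t),
    X.act t n k h r x = 0}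
  zero_mem' := ⟨0, fun _ _ _ _ _ => map_zero _⟩
  add_mem' := by
    rintro x y ⟨a, ha⟩ ⟨b, hb⟩
    refine ⟨max a b, fun t ht k h r => ?_⟩
    rw [map_add, ha t (le_of_max_le_left ht), hb t (le_of_max_le_right ht), add_zero]
  neg_mem' := by
    rintro x ⟨a, ha⟩
    exact ⟨a, fun t ht k h r => by rw [map_neg, ha t ht, neg_zero]⟩

lemma isSub_torsion (X : GrMod 𝒜) : X.IsSub X.torsion := by
  rintro m n k h r x ⟨t₀, ht₀⟩
  refine ⟨t₀, fun t ht l hl s => ?_⟩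
  rw [← X.mul_act t m n k l h hl (by push_cast; omega)]
  exact ht₀ (t + m) (by omega) l _ _

variable (𝒜) in
/-- The functor `Γ_{R₊}` on graded modules. -/
def Γ : GrMod 𝒜 ⥤ GrMod 𝒜 where
  obj X := X.sub X.torsion X.isSub_torsion
  map {X Y} f := subLift _ Y.isSub_torsion (subι X _ X.isSub_torsion ≫ f) (by
    rintro n ⟨x, t₀, ht₀⟩
    refine ⟨t₀, fun t ht k h r => ?_⟩
    change Y.act t n k h r (f.app n x) = 0
    rw [← f.comm, ht₀ t ht, map_zero])

instance : (Γ 𝒜).Additive where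

/-- The local cohomology graded module `H^i_{R₊}(X)`: the `i`-th right derived functor of
`Γ_{R₊}`. -/
def localCohomology (i : ℕ) (X : GrMod 𝒜) : GrMod 𝒜 := ((Γ 𝒜).rightDerived i).obj X

/-- `a(H) = sup {t | H_t ≠ 0}`, which is `-∞` (that is, `⊥`) if `H = 0`. -/
def aInv (H : GrMod 𝒜) : WithBot (WithTop ℤ) :=
  sSup {d | ∃ t : ℤ, Nontrivial (H.X t) ∧ d = ((t : WithTop ℤ) : WithBot (WithTop ℤ))}

/-- The Castelnuovo-Mumford regularity `reg(X) = sup {a(H^i(X)) + i | i ≥ 0}`. -/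
def reg (X : GrMod 𝒜) : WithBot (WithTop ℤ) :=
  ⨆ i : ℕ, aInv (localCohomology i X) + (((i : ℤ) : WithTop ℤ) : WithBot (WithTop ℤ))

/-- `X` is `t`-regular: `H^i(X)_{n-i+1} = 0` for all `i ≥ 0` and `n ≥ t`. -/
def IsRegular (X : GrMod 𝒜) (t : ℤ) : Prop :=
  ∀ (i : ℕ) (n : ℤ), t ≤ n → Subsingleton ((localCohomology i X).X (n - i + 1))

/-- `X` is weakly `t`-regular: `H^i(X)_{t-i+1} = 0` for all `i ≥ 0`. -/
def IsWeaklyRegular (X : GrMod 𝒜) (t : ℤ) : Prop :=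
  ∀ i : ℕ, Subsingleton ((localCohomology i X).X (t - i + 1))

end GrMod

/-! ## Gradings on modules, minimal generators -/

/-- `ℳ` is a `ℤ`-grading of the `R`-module `M`, compatible with the grading `𝒜` of `R`. -/
structure IsModuleGrading {R : Type u} [CommRing R] (𝒜 : ℕ → AddSubgroup R)
    {M : Type u} [AddCommGroup M] [Module R M] (ℳ : ℤ → AddSubgroup M) : Prop where
  isInternal : DirectSum.IsInternal ℳ
  smul_mem : ∀ (m : ℕ) (n : ℤ) (r : R) (x : M), r ∈ 𝒜 m → x ∈ ℳ n → r • x ∈ ℳ (m + n)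

/-- A graded `R`-module, as an object of the category of graded modules. -/
def IsModuleGrading.toGrMod {R : Type u} [CommRing R] {𝒜 : ℕ → AddSubgroup R} [GradedRing 𝒜]
    {M : Type u} [AddCommGroup M] [Module R M] {ℳ : ℤ → AddSubgroup M}
    (h : IsModuleGrading 𝒜 ℳ) : GrMod 𝒜 where
  X n := ℳ n
  act m n k hk := AddMonoidHom.mk'
    (fun r => AddMonoidHom.mk'
      (fun x => ⟨(r : R) • (x : M), hk ▸ h.smul_mem m n r x r.2 x.2⟩)
      (fun x y => Subtype.ext (smul_add (r : R) (x : M) y)))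
    (fun r s => by ext x; exact add_smul (r : R) (s : R) (x : M))
  one_act n _ x := Subtype.ext (one_smul R (x : M))
  mul_act a b n m k _ _ _ r s x := Subtype.ext (mul_smul (r : R) (s : R) (x : M))

/-- A minimal set of homogeneous generators of `M`. -/
structure IsMinimalHomogeneousGenerators (R : Type u) [CommRing R] {M : Type u} [AddCommGroup M]
    [Module R M] (ℳ : ℤ → AddSubgroup M) (S : Set M) : Prop where
  homogeneous : ∀ x ∈ S, ∃ n, x ∈ ℳ n
  span_eq_top : Submodule.span R S = ⊤
  minimal : ∀ x ∈ S, Submodule.span R (S \ {x}) ≠ ⊤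

/-- `d(M)`: the maximal degree of the elements of minimal sets of homogeneous generators of `M`,
which is `-∞` (that is, `⊥`) if `M = 0`. -/
def maxGeneratorDegree (R : Type u) [CommRing R] {M : Type u} [AddCommGroup M]
    [Module R M] (ℳ : ℤ → AddSubgroup M) : WithBot (WithTop ℤ) :=
  sSup {d | ∃ (S : Set M) (x : M) (n : ℤ), IsMinimalHomogeneousGenerators R ℳ S ∧
    x ∈ S ∧ x ∈ ℳ n ∧ d = ((n : WithTop ℤ) : WithBot (WithTop ℤ))}

end

/-! Say that the pair `(i, n)` lies on the line `w` if `i + n = w`. Weak `t`-regularity is the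
vanishing of `H^i(M)_n` on the single line `t + 1`; `t`-regularity is its vanishing on every line `w
≥ t + 1`. Let `l` be a finite list of elements of `R_1` generating `R_+`. The theorem rests on three
facts.

Vanishing on the line `w` passes to the line `w + 1` if `M_{w+1}` is generated by `l` and `M_w`
(`EventuallyGenerated.subsingleton_succ`). Vanishing on the line `w` forces `M_w` to be generated by
`l` and `M_{w-1}` (`EventuallyGenerated.generatedIn`). All lines beyond some `t` vanish
(`EventuallyGenerated.exists_subsingleton`). Since `d(M) ≤ t` means that there are no new generators
in degrees above `t` (`maxGeneratorDegree_le_iff`), the first fact gives (a). The second shows that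
a `t`-regular module has `d(M) ≤ t`, so the set in (b) is exactly the set of `t` for which `M` is
`t`-regular; it is nonempty by the third fact and bounded below by `d(M)`.

The three facts come from the Koszul cochain complex `K` of `M` on `l`. Its term `K^p` is built from
copies of `M(p)`, its initial term is `M`, its last term is `M(r)` with `r` the length of `l`, and
the cokernel of its last differential is `(M/R_+M)(r)`. Each element of `l` acts on `K` by a map
homotopic to zero, so it annihilates the cohomology of `K`; by Noetherianity this cohomology then
vanishes in large degrees. A module bounded above is its own `H^0` and has no higher local
cohomology, so in the short exact sequences linking terms, cocycles, boundaries and cokernels the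
cohomology of `K` hardly interferes. Working along `K` towards its last term gives the first two
facts. For the third, an induction on `i` shows that `H^i(M) → H^i(K^1)` is injective in large
degrees; this map kills whatever `l` kills, and `H^i(M)` is `R_+`-torsion. -/

noncomputable section

/-! ### Injective resolutions and the horseshoe lemma -/

namespace CategoryTheory

universe v w

variable {C : Type w} [Category.{v} C] [Abelian C]

namespace InjectiveResolution

/-- The augmentation of an injective resolution. -/
def aug {X : C} (I : InjectiveResolution X) : X ⟶ I.cocomplex.X 0 := I.ι.f 0

instance {X : C} (I : InjectiveResolution X) : Mono I.aug :=
  inferInstanceAs (Mono (I.ι.f 0))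

@[simp]
lemma aug_d {X : C} (I : InjectiveResolution X) : I.aug ≫ I.cocomplex.d 0 1 = 0 :=
  I.ι_f_zero_comp_complex_d

lemma exact_aug {X : C} (I : InjectiveResolution X) :
    (ShortComplex.mk I.aug (I.cocomplex.d 0 1) I.aug_d).Exact := I.exact₀

/-- An injective resolution from a complex of injective objects, an augmentation and the
exactness of the augmented complex. -/
def ofExact {X : C} (K : CochainComplex C ℕ) (hK : ∀ n, Injective (K.X n)) (i : X ⟶ K.X 0)
    [Mono i] (w : i ≫ K.d 0 1 = 0) (h₀ : (ShortComplex.mk i (K.d 0 1) w).Exact)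
    (h₁ : ∀ n, K.ExactAt (n + 1)) : InjectiveResolution X where
  cocomplex := K
  injective := hK
  ι := (CochainComplex.fromSingle₀Equiv _ _).symm ⟨i, w⟩
  quasiIso := ⟨fun n => by
    cases n
    · rw [CochainComplex.quasiIsoAt₀_iff, ShortComplex.quasiIso_iff_of_zeros]
      · refine (ShortComplex.exact_and_mono_f_iff_of_iso ?_).2 ⟨h₀, by dsimp; infer_instance⟩
        exact ShortComplex.isoMk (Iso.refl _) (Iso.refl _) (Iso.refl _)
          (by simp; exact (Category.id_comp i).trans (Category.comp_id i).symm)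
          (by simp; exact (Category.id_comp (K.d 0 1)).trans (Category.comp_id (K.d 0 1)).symm)
      · rfl
      · rfl
      · exact K.shape 0 0 (by simp)
    · rw [quasiIsoAt_iff_exactAt]
      · apply h₁
      · apply CochainComplex.exactAt_succ_single_obj⟩

@[simp]
lemma ofExact_aug {X : C} (K : CochainComplex C ℕ) (hK : ∀ n, Injective (K.X n))
    (i : X ⟶ K.X 0) [Mono i] (w : i ≫ K.d 0 1 = 0)
    (h₀ : (ShortComplex.mk i (K.d 0 1) w).Exact) (h₁ : ∀ n, K.ExactAt (n + 1)) :
    (ofExact K hK i w h₀ h₁).aug = i := by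
  simp [ofExact, aug]

/-- A morphism to the first cocycles of a resolution lifts to a family of morphisms that
anticommutes with the differentials. -/
lemma exists_twist {X Y : C} (I : InjectiveResolution X) (J : InjectiveResolution Y)
    (γ : Y ⟶ I.cocomplex.X 1) (hγ : γ ≫ I.cocomplex.d 1 2 = 0) :
    ∃ θ : ∀ n, J.cocomplex.X n ⟶ I.cocomplex.X (n + 1), J.aug ≫ θ 0 = γ ∧
      ∀ n, J.cocomplex.d n (n + 1) ≫ θ (n + 1) + θ n ≫ I.cocomplex.d (n + 1) (n + 2) = 0 := by
  -- The recursion carries two consecutive components together with their relation, because that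
  -- relation is what allows the next component to be extended from the image of the differential.
  let P : ℕ → Type v := fun n =>
    {p : (J.cocomplex.X n ⟶ I.cocomplex.X (n + 1)) ×
      (J.cocomplex.X (n + 1) ⟶ I.cocomplex.X (n + 2)) //
        J.cocomplex.d n (n + 1) ≫ p.2 + p.1 ≫ I.cocomplex.d (n + 1) (n + 2) = 0}
  let θ₀ : J.cocomplex.X 0 ⟶ I.cocomplex.X 1 := Injective.factorThru γ J.aug
  have h₀ : J.aug ≫ θ₀ = γ := Injective.comp_factorThru γ J.aug
  have w₀ : J.aug ≫ (-(θ₀ ≫ I.cocomplex.d 1 2)) = 0 := by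
    rw [Preadditive.comp_neg, reassoc_of% h₀, hγ, neg_zero]
  let θ₁ : J.cocomplex.X 1 ⟶ I.cocomplex.X 2 := J.exact_aug.descToInjective _ w₀
  have h₁ : J.cocomplex.d 0 1 ≫ θ₁ = -(θ₀ ≫ I.cocomplex.d 1 2) :=
    J.exact_aug.comp_descToInjective _ w₀
  let start : P 0 := ⟨(θ₀, θ₁), by simp [h₁]⟩
  have step : ∀ n (p : P n), ∃ q : P (n + 1), q.1.1 = p.1.2 := by
    rintro n ⟨⟨a, b⟩, h⟩
    have w : J.cocomplex.d n (n + 1) ≫ (-(b ≫ I.cocomplex.d (n + 2) (n + 3))) = 0 := by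
      rw [Preadditive.comp_neg, ← Category.assoc, eq_neg_of_add_eq_zero_left h]
      simp
    refine ⟨⟨(b, (J.exact_succ n).descToInjective _ w), ?_⟩, rfl⟩
    rw [show J.cocomplex.d (n + 1) (n + 1 + 1) ≫ (J.exact_succ n).descToInjective _ w = _ from
      (J.exact_succ n).comp_descToInjective _ w]
    simp
  choose next hnext using step
  let seq : ∀ n, P n := fun n => Nat.rec start next n
  refine ⟨fun n => (seq n).1.1, h₀, fun n => ?_⟩
  have : (seq (n + 1)).1.1 = (seq n).1.2 := hnext n (seq n)
  dsimp only
  rw [this]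
  exact (seq n).2

section horseshoe

variable {S : ShortComplex C} (I : InjectiveResolution S.X₁) (J : InjectiveResolution S.X₃)
  (θ : ∀ n, J.cocomplex.X n ⟶ I.cocomplex.X (n + 1))
  (hθ : ∀ n, J.cocomplex.d n (n + 1) ≫ θ (n + 1) + θ n ≫ I.cocomplex.d (n + 1) (n + 2) = 0)

/-- The direct sum of two complexes with a twisted differential. -/
abbrev twistedSum : CochainComplex C ℕ :=
  CochainComplex.of (fun n => I.cocomplex.X n ⊞ J.cocomplex.X n)
    (fun n => biprod.desc (I.cocomplex.d n (n + 1) ≫ biprod.inl)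
      (θ n ≫ biprod.inl + J.cocomplex.d n (n + 1) ≫ biprod.inr)) (fun n => by
    ext
    · simp
    · simp
    · have := hθ n
      simp [add_comm] at this ⊢
      exact this
    · simp)

lemma twistedSum_d (n : ℕ) : (twistedSum I J θ hθ).d n (n + 1) =
    (biprod.desc (I.cocomplex.d n (n + 1) ≫ biprod.inl)
      (θ n ≫ biprod.inl + J.cocomplex.d n (n + 1) ≫ biprod.inr) :
        I.cocomplex.X n ⊞ J.cocomplex.X n ⟶ I.cocomplex.X (n + 1) ⊞ J.cocomplex.X (n + 1)) := by
  simp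

/-- The inclusion of the first summand into the twisted sum. -/
def twistedSumInl : I.cocomplex ⟶ twistedSum I J θ hθ where
  f n := biprod.inl
  comm' i j hij := by
    obtain rfl : i + 1 = j := hij
    simp

/-- The projection of the twisted sum onto the second summand. -/
def twistedSumSnd : twistedSum I J θ hθ ⟶ J.cocomplex where
  f n := biprod.snd
  comm' i j hij := by
    obtain rfl : i + 1 = j := hij
    ext <;> simp

/-- The short complex of complexes given by the twisted sum. -/
def twistedSumShortComplex : ShortComplex (CochainComplex C ℕ) :=
  ShortComplex.mk (twistedSumInl I J θ hθ) (twistedSumSnd I J θ hθ) (by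
    ext n
    exact biprod.inl_snd)

/-- The twisted sum splits in each degree. -/
def twistedSumSplitting (n : ℕ) :
    ((twistedSumShortComplex I J θ hθ).map (HomologicalComplex.eval C _ n)).Splitting where
  r := (biprod.fst : I.cocomplex.X n ⊞ J.cocomplex.X n ⟶ I.cocomplex.X n)
  s := (biprod.inr : J.cocomplex.X n ⟶ I.cocomplex.X n ⊞ J.cocomplex.X n)
  f_r := biprod.inl_fst
  s_g := biprod.inr_snd
  id := biprod.total

lemma twistedSum_shortExact : (twistedSumShortComplex I J θ hθ).ShortExact :=
  HomologicalComplex.shortExact_of_degreewise_shortExact _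
    fun n => (twistedSumSplitting I J θ hθ n).shortExact

lemma twistedSum_exactAt_succ (n : ℕ) : (twistedSum I J θ hθ).ExactAt (n + 1) :=
  (twistedSum_shortExact I J θ hθ).exactAt_X₂ _ (I.cocomplex_exactAt_succ n)
    (J.cocomplex_exactAt_succ n)

instance (n : ℕ) : Injective ((twistedSum I J θ hθ).X n) :=
  inferInstanceAs (Injective (I.cocomplex.X n ⊞ J.cocomplex.X n))

variable (β : S.X₂ ⟶ I.cocomplex.X 0) (hβ : S.f ≫ β = I.aug)
  (hβθ : β ≫ I.cocomplex.d 0 1 + S.g ≫ J.aug ≫ θ 0 = 0)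

/-- The augmentation of the twisted sum. -/
abbrev twistedSumAug : S.X₂ ⟶ (twistedSum I J θ hθ).X 0 :=
  (biprod.lift β (S.g ≫ J.aug) : S.X₂ ⟶ I.cocomplex.X 0 ⊞ J.cocomplex.X 0)

include hβθ in
lemma twistedSumAug_d : twistedSumAug I J θ hθ β ≫ (twistedSum I J θ hθ).d 0 1 = 0 := by
  rw [twistedSum_d, twistedSumAug]
  ext
  · simpa [biprod.lift_desc] using hβθ
  · simp [biprod.lift_desc]

include hβ in
lemma mono_twistedSumAug (hS : S.ShortExact) : Mono (twistedSumAug I J θ hθ β) := by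
  refine Preadditive.mono_of_cancel_zero _ (fun {Z} z hz => ?_)
  have h₁ : z ≫ β = 0 := by
    have := hz =≫ (biprod.fst : I.cocomplex.X 0 ⊞ J.cocomplex.X 0 ⟶ _)
    rw [twistedSumAug] at this
    simpa using this
  have h₂ : z ≫ S.g = 0 := by
    have := hz =≫ (biprod.snd : I.cocomplex.X 0 ⊞ J.cocomplex.X 0 ⟶ _)
    rw [twistedSumAug] at this
    rw [← cancel_mono J.aug]
    simpa using this
  have := hS.mono_f
  obtain ⟨y, rfl⟩ : ∃ y, z = y ≫ S.f := ⟨hS.exact.lift z h₂, (hS.exact.lift_f z h₂).symm⟩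
  rw [Category.assoc, hβ] at h₁
  rw [zero_of_comp_mono _ h₁, zero_comp]

-- A diagram chase with generalized elements. The `J`-component of a cocycle comes from `X₃`, hence
-- from `X₂` after an epimorphism; once that preimage is subtracted, `hβθ` makes the remaining
-- `I`-component a cocycle, so it comes from `X₁`.
include hβ in
lemma exact_twistedSumAug (hS : S.ShortExact) :
    (ShortComplex.mk _ _ (twistedSumAug_d I J θ hθ β hβθ)).Exact := by
  rw [ShortComplex.exact_iff_exact_up_to_refinements]
  intro A z hz
  change A ⟶ I.cocomplex.X 0 ⊞ J.cocomplex.X 0 at z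
  replace hz : z ≫ (twistedSum I J θ hθ).d 0 1 = 0 := hz
  rw [twistedSum_d] at hz
  have h₁ : z ≫ biprod.fst ≫ I.cocomplex.d 0 1 + z ≫ biprod.snd ≫ θ 0 = 0 := by
    have := hz =≫ biprod.fst
    simpa [biprod.desc_eq] using this
  have h₂ : (z ≫ biprod.snd) ≫ J.cocomplex.d 0 1 = 0 := by
    have := hz =≫ biprod.snd
    simpa [biprod.desc_eq] using this
  let c : A ⟶ S.X₃ := J.exact_aug.lift _ h₂
  have hc : c ≫ J.aug = z ≫ biprod.snd := J.exact_aug.lift_f _ h₂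
  have := hS.epi_g
  obtain ⟨A', π, hπ, b, hb⟩ := surjective_up_to_refinements_of_epi S.g c
  have h₃ : (π ≫ z ≫ biprod.fst - b ≫ β) ≫ I.cocomplex.d 0 1 = 0 := by
    have e : b ≫ β ≫ I.cocomplex.d 0 1 = - π ≫ z ≫ biprod.snd ≫ θ 0 := by
      rw [eq_neg_of_add_eq_zero_left hβθ, Preadditive.comp_neg, ← reassoc_of% hb,
        reassoc_of% hc]
    rw [Preadditive.sub_comp, Category.assoc, Category.assoc, Category.assoc, e, sub_neg_eq_add,
      ← Preadditive.comp_add, h₁, comp_zero]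
  let y : A' ⟶ S.X₁ := I.exact_aug.lift _ h₃
  have hy : y ≫ I.aug = π ≫ z ≫ biprod.fst - b ≫ β := I.exact_aug.lift_f _ h₃
  refine ⟨A', π, hπ, b + y ≫ S.f, ?_⟩
  change π ≫ z = (b + y ≫ S.f) ≫ biprod.lift β (S.g ≫ J.aug)
  ext
  · simp [hβ, hy]
  · simp [← hc, reassoc_of% hb]

/-- **Horseshoe lemma**: injective resolutions of the outer terms of a short exact sequence fit
into a degreewise split short exact sequence of injective resolutions. -/
lemma exists_horseshoe (hS : S.ShortExact) :
    ∃ (K : InjectiveResolution S.X₂) (φ : I.cocomplex ⟶ K.cocomplex)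
      (ψ : K.cocomplex ⟶ J.cocomplex) (w : φ ≫ ψ = 0),
      I.aug ≫ φ.f 0 = S.f ≫ K.aug ∧ K.aug ≫ ψ.f 0 = S.g ≫ J.aug ∧
      ∀ n, Nonempty
        (((ShortComplex.mk φ ψ w).map (HomologicalComplex.eval C _ n)).Splitting) := by
  have := hS.mono_f
  have := hS.epi_g
  let β : S.X₂ ⟶ I.cocomplex.X 0 := Injective.factorThru I.aug S.f
  have hβ : S.f ≫ β = I.aug := Injective.comp_factorThru I.aug S.f
  have w : S.f ≫ (-(β ≫ I.cocomplex.d 0 1)) = 0 := by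
    rw [Preadditive.comp_neg, reassoc_of% hβ, aug_d, neg_zero]
  -- The extension `β` of the augmentation of `I` need not be a cocycle. Its defect `-(β ≫ d)`
  -- vanishes on `X₁`, so it descends to `X₃`, and the twist `θ` is a lift of it to `J`.
  obtain ⟨θ, hγ, hθ⟩ := exists_twist I J (hS.exact.desc _ w) (by
    rw [← cancel_epi S.g, hS.exact.g_desc_assoc]
    simp)
  have hβθ : β ≫ I.cocomplex.d 0 1 + S.g ≫ J.aug ≫ θ 0 = 0 := by
    rw [hγ, hS.exact.g_desc]
    simp
  have := mono_twistedSumAug I J θ hθ β hβ hS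
  refine ⟨ofExact (twistedSum I J θ hθ) inferInstance _ _
    (exact_twistedSumAug I J θ hθ β hβ hβθ hS) (twistedSum_exactAt_succ I J θ hθ),
    twistedSumInl I J θ hθ, twistedSumSnd I J θ hθ, (twistedSumShortComplex I J θ hθ).zero,
    ?_, ?_, fun n => ⟨twistedSumSplitting I J θ hθ n⟩⟩
  · rw [ofExact_aug]
    change I.aug ≫ (biprod.inl : _ ⟶ I.cocomplex.X 0 ⊞ J.cocomplex.X 0) =
      S.f ≫ biprod.lift β (S.g ≫ J.aug)
    ext
    · simp [hβ]
    · simp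
  · rw [ofExact_aug]
    exact biprod.lift_snd _ _

end horseshoe
end InjectiveResolution

/-! ### Long exact sequence of right derived functors -/

namespace Functor

variable {D : Type*} [Category* D] [Abelian D] [EnoughInjectives C] (F : C ⥤ D) [F.Additive]

/-- The long exact sequence of the right derived functors of an additive functor. -/
lemma exists_rightDerived_exact {S : ShortComplex C} (hS : S.ShortExact) (n : ℕ) :
    ∃ (δ : (F.rightDerived n).obj S.X₃ ⟶ (F.rightDerived (n + 1)).obj S.X₁)
      (w₁ : δ ≫ (F.rightDerived (n + 1)).map S.f = 0)
      (w₂ : (F.rightDerived n).map S.f ≫ (F.rightDerived n).map S.g = 0)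
      (w₃ : (F.rightDerived n).map S.g ≫ δ = 0),
      (ShortComplex.mk _ _ w₁).Exact ∧ (ShortComplex.mk _ _ w₂).Exact ∧
        (ShortComplex.mk _ _ w₃).Exact ∧ (n = 0 → Mono ((F.rightDerived n).map S.f)) := by
  let I : InjectiveResolution S.X₁ := InjectiveResolution.of _
  let J : InjectiveResolution S.X₃ := InjectiveResolution.of _
  obtain ⟨K, φ, ψ, w, hφ, hψ, hs⟩ := InjectiveResolution.exists_horseshoe I J hS
  let T := (ShortComplex.mk φ ψ w).map (F.mapHomologicalComplex (ComplexShape.up ℕ))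
  -- An additive functor preserves split sequences, so degreewise splitting replaces any exactness
  -- of `F`.
  have hT : T.ShortExact := HomologicalComplex.shortExact_of_degreewise_shortExact _
    fun n => ((hs n).some.map F).shortExact
  obtain ⟨eI, eK, eJ, nf, ng⟩ : ∃ (eI : ∀ n, (F.rightDerived n).obj S.X₁ ≅ T.X₁.homology n)
      (eK : ∀ n, (F.rightDerived n).obj S.X₂ ≅ T.X₂.homology n)
      (eJ : ∀ n, (F.rightDerived n).obj S.X₃ ≅ T.X₃.homology n),
      (∀ n, (F.rightDerived n).map S.f ≫ (eK n).hom =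
        (eI n).hom ≫ HomologicalComplex.homologyMap T.f n) ∧
      (∀ n, (F.rightDerived n).map S.g ≫ (eJ n).hom =
        (eK n).hom ≫ HomologicalComplex.homologyMap T.g n) :=
    ⟨I.isoRightDerivedObj F, K.isoRightDerivedObj F, J.isoRightDerivedObj F,
      InjectiveResolution.isoRightDerivedObj_hom_naturality S.f I K φ hφ F,
      InjectiveResolution.isoRightDerivedObj_hom_naturality S.g K J ψ hψ F⟩
  have hij : (ComplexShape.up ℕ).Rel n (n + 1) := rfl
  let δ := (eJ n).hom ≫ hT.δ n (n + 1) hij ≫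
    (eI (n + 1)).inv
  have hδ : δ ≫ (eI (n + 1)).hom =
      (eJ n).hom ≫ hT.δ n (n + 1) hij := by
    simp [δ]
  have w₁ : δ ≫ (F.rightDerived (n + 1)).map S.f = 0 := by
    rw [← cancel_mono (eK (n + 1)).hom, Category.assoc, nf, ← Category.assoc,
      hδ, Category.assoc, hT.δ_comp, comp_zero, zero_comp]
  have w₂ : (F.rightDerived n).map S.f ≫ (F.rightDerived n).map S.g = 0 := by
    rw [← cancel_mono (eJ n).hom, Category.assoc, ng, ← Category.assoc, nf,
      Category.assoc, ← HomologicalComplex.homologyMap_comp, T.zero,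
      HomologicalComplex.homologyMap_zero, comp_zero, zero_comp]
  have w₃ : (F.rightDerived n).map S.g ≫ δ = 0 := by
    rw [← cancel_mono (eI (n + 1)).hom, Category.assoc, hδ, ← Category.assoc,
      ng, Category.assoc, hT.comp_δ, comp_zero, zero_comp]
  refine ⟨δ, w₁, w₂, w₃, ?_, ?_, ?_, ?_⟩
  · exact (ShortComplex.exact_iff_of_iso (ShortComplex.isoMk (eJ n)
      (eI (n + 1)) (eK (n + 1))
      hδ.symm (nf (n + 1)).symm)).2 (hT.homology_exact₁ n (n + 1) hij)
  · exact (ShortComplex.exact_iff_of_iso (ShortComplex.isoMk (eI n)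
      (eK n) (eJ n)
      (nf n).symm (ng n).symm)).2 (hT.homology_exact₂ n)
  · exact (ShortComplex.exact_iff_of_iso (ShortComplex.isoMk (eK n)
      (eJ n) (eI (n + 1))
      (ng n).symm hδ.symm)).2 (hT.homology_exact₃ n (n + 1) hij)
  · rintro rfl
    have := hT.mono_f
    -- No differential ends in position zero, so homology there is a subobject of the term and a
    -- monomorphism stays one.
    have : Mono (HomologicalComplex.homologyMap T.f 0) :=
      HomologicalComplex.mono_homologyMap_of_mono_of_not_rel T.f 0 (by simp)
    have : Mono ((F.rightDerived 0).map S.f ≫ (eK 0).hom) := by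
      rw [nf 0]
      infer_instance
    exact mono_of_mono _ (eK 0).hom

end Functor
end CategoryTheory

namespace GrMod

variable {R : Type u} [CommRing R] {𝒜 : ℕ → AddSubgroup R} [GradedRing 𝒜]

/-! ### Exactness in terms of elements -/

lemma mono_of_injective {X Y : GrMod 𝒜} (f : X ⟶ Y) (hf : ∀ n, Function.Injective (f.app n)) :
    Mono f where
  right_cancellation g h e := by
    ext n x
    exact hf n (congrArg (fun φ => Hom.app φ n x) e)

lemma epi_of_surjective {X Y : GrMod 𝒜} (f : X ⟶ Y) (hf : ∀ n, Function.Surjective (f.app n)) :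
    Epi f where
  left_cancellation g h e := by
    ext n y
    obtain ⟨x, rfl⟩ := hf n y
    exact congrArg (fun φ => Hom.app φ n x) e

/-- The explicit kernel and cokernel of graded modules are compared with the chosen ones. Later
diagram chases are done with elements through this criterion. -/
lemma exact_iff (S : ShortComplex (GrMod 𝒜)) :
    S.Exact ↔ ∀ n (x : S.X₂.X n), S.g.app n x = 0 → ∃ y, S.f.app n y = x := by
  rw [S.exact_iff_kernel_ι_comp_cokernel_π_zero]
  constructor
  · intro h n x hx
    have h' : subι S.X₂ _ (isSub_ker S.g) ≫ quotπ S.X₂ _ (isSub_range S.f) = 0 := by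
      rw [← kernel.lift_ι S.g _ (subι_comp S.g), ← cokernel.π_desc S.f _ (comp_quotπ S.f),
        Category.assoc, reassoc_of% h, zero_comp, comp_zero]
    have := congrArg (fun φ => Hom.app φ n (⟨x, hx⟩ : (S.g.app n).ker)) h'
    exact (QuotientAddGroup.eq_zero_iff (N := (S.f.app n).range) x).1 this
  · intro h
    ext n x
    have hx : S.g.app n ((kernel.ι S.g).app n x) = 0 :=
      congrArg (fun φ => Hom.app φ n x) (kernel.condition S.g)
    obtain ⟨y, hy⟩ := h n _ hx
    rw [comp_app, ← hy]
    exact congrArg (fun φ => Hom.app φ n y) (cokernel.condition S.f)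

lemma shortExact_of_elements {X Y Z : GrMod 𝒜} (f : X ⟶ Y) (g : Y ⟶ Z) (w : f ≫ g = 0)
    (hf : ∀ n, Function.Injective (f.app n)) (hg : ∀ n, Function.Surjective (g.app n))
    (h : ∀ n y, g.app n y = 0 → ∃ x, f.app n x = y) : (ShortComplex.mk f g w).ShortExact where
  exact := (exact_iff _).2 h
  mono_f := mono_of_injective f hf
  epi_g := epi_of_surjective g hg

lemma exactAt_succ_iff (K : CochainComplex (GrMod 𝒜) ℕ) (i : ℕ) :
    K.ExactAt (i + 1) ↔ ∀ n (x : (K.X (i + 1)).X n), (K.d (i + 1) (i + 2)).app n x = 0 →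
      ∃ y, (K.d i (i + 1)).app n y = x := by
  rw [K.exactAt_iff' i (i + 1) (i + 2) (by simp) (by simp), exact_iff]
  rfl

@[simp]
lemma iso_inv_hom_app {X Y : GrMod 𝒜} (e : X ≅ Y) (n : ℤ) (y : Y.X n) :
    e.hom.app n (e.inv.app n y) = y :=
  congrArg (fun φ => Hom.app φ n y) e.inv_hom_id

lemma iso_injective {X Y : GrMod 𝒜} (e : X ≅ Y) (n : ℤ) : Function.Injective (e.hom.app n) :=
  injective_of_mono e.hom n

lemma subsingleton_of_iso {X Y : GrMod 𝒜} (e : X ≅ Y) {n : ℤ} (h : Subsingleton (X.X n)) :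
    Subsingleton (Y.X n) := by
  refine subsingleton_of_forall_eq 0 (fun y => ?_)
  rw [← iso_inv_hom_app e n y, Subsingleton.elim (e.inv.app n y) 0, map_zero]

lemma subsingleton_of_isZero {X : GrMod 𝒜} (h : IsZero X) (n : ℤ) : Subsingleton (X.X n) :=
  subsingleton_of_forall_eq 0 fun x => congrArg (fun φ => Hom.app φ n x) ((IsZero.iff_id_eq_zero X).1 h)

/-! ### Homology in terms of elements -/

/-- The homology class `u` is represented by the cocycle `z`. -/
def IsClass (K : CochainComplex (GrMod 𝒜) ℕ) (i : ℕ) (n : ℤ) (z : (K.X i).X n)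
    (u : (K.homology i).X n) : Prop :=
  ∃ c : (K.cycles i).X n, (K.iCycles i).app n c = z ∧ (K.homologyπ i).app n c = u

section

variable {K L : CochainComplex (GrMod 𝒜) ℕ} {i : ℕ} {n : ℤ}

lemma exists_isClass_of_cocycle (z : (K.X i).X n) (hz : (K.d i (i + 1)).app n z = 0) :
    ∃ u, IsClass K i n z u := by
  have h : (ShortComplex.mk (K.iCycles i) (K.d i (i + 1)) (by simp)).Exact :=
    ShortComplex.exact_of_f_is_kernel _ (K.cyclesIsKernel i (i + 1) (by simp))
  obtain ⟨c, hc⟩ := (exact_iff _).1 h n z hz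
  exact ⟨_, c, hc, rfl⟩

lemma exists_isClass (u : (K.homology i).X n) : ∃ z, IsClass K i n z u := by
  obtain ⟨c, hc⟩ := surjective_of_epi (K.homologyπ i) n u
  exact ⟨_, c, rfl, hc⟩

lemma IsClass.d_eq_zero {z : (K.X i).X n} {u : (K.homology i).X n} (h : IsClass K i n z u)
    (j : ℕ) : (K.d i j).app n z = 0 := by
  obtain ⟨c, rfl, -⟩ := h
  exact congrArg (fun φ => Hom.app φ n c) (K.iCycles_d i j)

/-- The index `j` may range over all positions because `d j i` is zero unless `j + 1 = i`. For `i =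
0` the condition therefore reads `z = 0`. -/
lemma IsClass.eq_zero_iff {z : (K.X i).X n} {u : (K.homology i).X n} (h : IsClass K i n z u) :
    u = 0 ↔ ∃ (j : ℕ) (y : (K.X j).X n), (K.d j i).app n y = z := by
  obtain ⟨c, rfl, rfl⟩ := h
  constructor
  · intro h0
    have hex : (ShortComplex.mk (K.toCycles ((ComplexShape.up ℕ).prev i) i) (K.homologyπ i)
        (by simp)).Exact :=
      ShortComplex.exact_of_g_is_cokernel _ (K.homologyIsCokernel _ i rfl)
    obtain ⟨y, hy⟩ := (exact_iff _).1 hex n c h0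
    refine ⟨_, y, ?_⟩
    rw [← hy, ← comp_app]
    exact congrArg (fun φ => Hom.app φ n y) (K.toCycles_i _ i).symm
  · rintro ⟨j, y, hy⟩
    have : c = (K.toCycles j i).app n y := by
      apply injective_of_mono (K.iCycles i) n
      rw [← hy]
      exact congrArg (fun φ => Hom.app φ n y) (K.toCycles_i j i).symm
    rw [this]
    exact congrArg (fun φ => Hom.app φ n y) (K.toCycles_comp_homologyπ j i)

lemma IsClass.map (φ : K ⟶ L) {z : (K.X i).X n} {u : (K.homology i).X n}
    (h : IsClass K i n z u) :
    IsClass L i n ((φ.f i).app n z) ((HomologicalComplex.homologyMap φ i).app n u) := by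
  obtain ⟨c, rfl, rfl⟩ := h
  refine ⟨(HomologicalComplex.cyclesMap φ i).app n c, ?_, ?_⟩
  · exact congrArg (fun φ => Hom.app φ n c) (HomologicalComplex.cyclesMap_i φ i)
  · exact congrArg (fun φ => Hom.app φ n c) (HomologicalComplex.homologyπ_naturality φ i).symm

lemma IsClass.act {z : (K.X i).X n} {u : (K.homology i).X n} (h : IsClass K i n z u) (m : ℕ)
    (k : ℤ) (hk : (m : ℤ) + n = k) (r : 𝒜 m) :
    IsClass K i k ((K.X i).act m n k hk r z) ((K.homology i).act m n k hk r u) := by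
  obtain ⟨c, rfl, rfl⟩ := h
  exact ⟨(K.cycles i).act m n k hk r c, Hom.comm _ m n k hk r c, Hom.comm _ m n k hk r c⟩

end

/-! ### The long exact sequence of local cohomology -/

/-- An element is torsion in a submodule as soon as it is torsion in the ambient module. Left
exactness is what identifies the zeroth derived functor with `Γ`. -/
instance : PreservesFiniteLimits (Γ 𝒜) := by
  rw [Functor.preservesFiniteLimits_iff_forall_exact_map_and_mono]
  intro S hS
  have := hS.mono_f
  refine ⟨(exact_iff _).2 ?_, mono_of_injective _ ?_⟩
  · rintro n ⟨x, t₀, ht₀⟩ hx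
    obtain ⟨y, rfl⟩ := (exact_iff _).1 hS.exact n x (congrArg Subtype.val hx)
    refine ⟨⟨y, t₀, fun t ht k h r => injective_of_mono S.f k ?_⟩, rfl⟩
    rw [Hom.comm, ht₀ t ht, map_zero]
  · rintro n ⟨x, hx⟩ ⟨y, hy⟩ h
    exact Subtype.ext (injective_of_mono S.f n (congrArg Subtype.val h))

/-- Local cohomology in degree zero is the torsion submodule. -/
def localCohomologyZeroIso (X : GrMod 𝒜) : localCohomology 0 X ≅ (Γ 𝒜).obj X :=
  (Γ 𝒜).rightDerivedZeroIsoSelf.app X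

/-- The homomorphism induced on local cohomology. -/
def lcMap (i : ℕ) {X Y : GrMod 𝒜} (f : X ⟶ Y) : localCohomology i X ⟶ localCohomology i Y :=
  ((Γ 𝒜).rightDerived i).map f

lemma lcMap_comp (i : ℕ) {X Y Z : GrMod 𝒜} (f : X ⟶ Y) (g : Y ⟶ Z) :
    lcMap i (f ≫ g) = lcMap i f ≫ lcMap i g :=
  ((Γ 𝒜).rightDerived i).map_comp f g

variable {X Y Z : GrMod 𝒜} {f : X ⟶ Y} {g : Y ⟶ Z}

/-- Elementwise short exactness. -/
structure IsShortExact (f : X ⟶ Y) (g : Y ⟶ Z) : Prop where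
  injective : ∀ n, Function.Injective (f.app n)
  surjective : ∀ n, Function.Surjective (g.app n)
  comp : ∀ n x, g.app n (f.app n x) = 0
  exact : ∀ n y, g.app n y = 0 → ∃ x, f.app n x = y

namespace IsShortExact

lemma exists_exact (h : IsShortExact f g) (i : ℕ) :
    ∃ δ : localCohomology i Z ⟶ localCohomology (i + 1) X,
      (∀ n u, (lcMap (i + 1) f).app n u = 0 → ∃ v, δ.app n v = u) ∧
      (∀ n u, (lcMap i g).app n u = 0 → ∃ v, (lcMap i f).app n v = u) ∧
      (∀ n u, δ.app n u = 0 ↔ ∃ v, (lcMap i g).app n v = u) ∧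
      (i = 0 → ∀ n, Function.Injective ((lcMap i f).app n)) := by
  obtain ⟨δ, w₁, w₂, w₃, h₁, h₂, h₃, h₄⟩ := (Γ 𝒜).exists_rightDerived_exact
    (shortExact_of_elements f g (hom_ext h.comp) h.injective h.surjective h.exact) i
  refine ⟨δ, (exact_iff _).1 h₁, (exact_iff _).1 h₂, fun n u => ⟨(exact_iff _).1 h₃ n u, ?_⟩, fun hi n => ?_⟩
  · rintro ⟨v, rfl⟩
    exact congrArg (fun φ => Hom.app φ n v) w₃
  have := h₄ hi
  exact injective_of_mono (((Γ 𝒜).rightDerived i).map f) n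

/-- Vanishing of local cohomology of the middle term. -/
lemma subsingleton₂ (h : IsShortExact f g) {i : ℕ} {n : ℤ}
    (h₁ : Subsingleton ((localCohomology i X).X n))
    (h₃ : Subsingleton ((localCohomology i Z).X n)) :
    Subsingleton ((localCohomology i Y).X n) := by
  obtain ⟨-, -, h, -⟩ := h.exists_exact i
  refine subsingleton_of_forall_eq 0 (fun u => ?_)
  obtain ⟨v, rfl⟩ := h n u (Subsingleton.elim _ _)
  rw [Subsingleton.elim v 0, map_zero]

/-- Vanishing of local cohomology of the third term. -/
lemma subsingleton₃ (h : IsShortExact f g) {i : ℕ} {n : ℤ}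
    (h₂ : Subsingleton ((localCohomology i Y).X n))
    (h₁ : Subsingleton ((localCohomology (i + 1) X).X n)) :
    Subsingleton ((localCohomology i Z).X n) := by
  obtain ⟨δ, -, -, h, -⟩ := h.exists_exact i
  refine subsingleton_of_forall_eq 0 (fun u => ?_)
  obtain ⟨v, rfl⟩ := (h n u).1 (Subsingleton.elim _ _)
  rw [Subsingleton.elim v 0, map_zero]

lemma injective_lcMap_zero (h : IsShortExact f g) (n : ℤ) :
    Function.Injective ((lcMap 0 f).app n) := by
  obtain ⟨-, -, -, -, h⟩ := h.exists_exact 0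
  exact h rfl n

lemma injective_lcMap_succ (h : IsShortExact f g) {i : ℕ} {n : ℤ}
    (h₃ : Subsingleton ((localCohomology i Z).X n)) :
    Function.Injective ((lcMap (i + 1) f).app n) := by
  obtain ⟨δ, h, -⟩ := h.exists_exact i
  rw [injective_iff_map_eq_zero]
  intro u hu
  obtain ⟨v, rfl⟩ := h n u hu
  rw [Subsingleton.elim v 0, map_zero]

lemma injective_lcMap_right (h : IsShortExact f g) {i : ℕ} {n : ℤ}
    (h₁ : Subsingleton ((localCohomology i X).X n)) :
    Function.Injective ((lcMap i g).app n) := by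
  obtain ⟨-, -, h, -⟩ := h.exists_exact i
  rw [injective_iff_map_eq_zero]
  intro u hu
  obtain ⟨v, rfl⟩ := h n u hu
  rw [Subsingleton.elim v 0, map_zero]

/-- Vanishing of local cohomology of the first term. -/
lemma subsingleton₁_zero (h : IsShortExact f g) {n : ℤ}
    (h₂ : Subsingleton ((localCohomology 0 Y).X n)) :
    Subsingleton ((localCohomology 0 X).X n) :=
  (h.injective_lcMap_zero n).subsingleton

lemma subsingleton₁_succ (h : IsShortExact f g) {i : ℕ} {n : ℤ}
    (h₃ : Subsingleton ((localCohomology i Z).X n))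
    (h₂ : Subsingleton ((localCohomology (i + 1) Y).X n)) :
    Subsingleton ((localCohomology (i + 1) X).X n) :=
  (h.injective_lcMap_succ h₃).subsingleton

end IsShortExact

lemma subsingleton_localCohomology_zero {X : GrMod 𝒜} {n : ℤ}
    (h : Subsingleton (X.X n)) : Subsingleton ((localCohomology 0 X).X n) :=
  subsingleton_of_iso (localCohomologyZeroIso X).symm
    (Function.Injective.subsingleton (f := ((subι X _ X.isSub_torsion).app n))
      Subtype.val_injective)

lemma subsingleton_localCohomology_injective (X : GrMod 𝒜) [Injective X] (i : ℕ) (n : ℤ) :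
    Subsingleton ((localCohomology (i + 1) X).X n) :=
  subsingleton_of_isZero ((Γ 𝒜).isZero_rightDerived_obj_injective_succ i X) n

/-! ### Modules bounded above -/

/-- A graded module is bounded above if its components vanish in large degrees. -/
def IsBoundedAbove (X : GrMod 𝒜) : Prop := ∃ N : ℤ, ∀ n, N < n → Subsingleton (X.X n)

lemma IsBoundedAbove.torsion_eq_top {X : GrMod 𝒜} (hX : X.IsBoundedAbove) (n : ℤ) (x : X.X n) :
    x ∈ X.torsion n := by
  obtain ⟨N, hN⟩ := hX
  refine ⟨(N + 1 - n).toNat, fun t ht k h r => ?_⟩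
  have := hN k (by omega)
  exact Subsingleton.elim _ _

lemma IsBoundedAbove.subsingleton_iff {X : GrMod 𝒜} (hX : X.IsBoundedAbove) (n : ℤ) :
    Subsingleton ((localCohomology 0 X).X n) ↔ Subsingleton (X.X n) := by
  refine ⟨fun h => ?_, subsingleton_localCohomology_zero⟩
  have : Subsingleton ((X.sub X.torsion X.isSub_torsion).X n) :=
    subsingleton_of_iso (localCohomologyZeroIso X) h
  exact Function.Surjective.subsingleton (f := ((subι X _ X.isSub_torsion).app n))
    (fun x => ⟨⟨x, hX.torsion_eq_top n x⟩, rfl⟩)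

end GrMod

/-! ### Acyclicity of modules bounded above -/

namespace GrMod

variable {R : Type u} [CommRing R] {𝒜 : ℕ → AddSubgroup R} [GradedRing 𝒜]

/-- A graded module that is bounded above embeds into an injective one that is bounded above. -/
lemma IsBoundedAbove.exists_injective {X : GrMod 𝒜} (hX : X.IsBoundedAbove) :
    ∃ (E : GrMod 𝒜) (f : X ⟶ E), Injective E ∧ E.IsBoundedAbove ∧
      ∀ n, Function.Injective (f.app n) := by
  let G : ℤ → AddCommGrpCat.{u} := fun n => Injective.under (AddCommGrpCat.of (X.X n))
  let j : ∀ n, X.X n →+ G n := fun n => (Injective.ι (AddCommGrpCat.of (X.X n))).hom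
  have hj : ∀ n, Function.Injective (j n) := fun n =>
    (AddCommGrpCat.mono_iff_injective (Injective.ι (AddCommGrpCat.of (X.X n)))).1 inferInstance
  refine ⟨coind 𝒜 (fun n => G n), coindLift _ j, coind_injective _ fun n => ?_, ?_,
    fun n x y hxy => hj n ?_⟩
  · exact inferInstanceAs (Injective (Injective.under (AddCommGrpCat.of (X.X n))))
  · obtain ⟨N, hN⟩ := hX
    -- The component of degree `k` of the coinduced module is a product of groups `Hom(R_m, G n)`
    -- with `n = m + k ≥ k`, so it vanishes for `k > N` once the `G n` with `n > N` do. This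
    -- requires the chosen injective group over a zero group to be zero.
    have hG : ∀ n, N < n → Subsingleton (G n) := fun n hn => by
      have := hN n hn
      exact AddCommGrpCat.subsingleton_of_isZero (Injective.isZero_under _
        (AddCommGrpCat.isZero_of_subsingleton (AddCommGrpCat.of (X.X n))))
    refine ⟨N, fun k hk => ⟨fun φ ψ => funext fun (p : Idx k) => ?_⟩⟩
    have := hG p.1.2 (by have := p.2; omega)
    exact AddMonoidHom.ext fun s => Subsingleton.elim _ _
  · have h : ∀ x : X.X n, coindEval (fun n => G n) (coindLift _ j) n x = j n x := fun x =>
      congrArg (j n) (X.one_act n (by simp) x)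
    rw [← h x, ← h y]
    exact congrArg (fun φ : ∀ p : Idx n, 𝒜 p.1.1 →+ G p.1.2 => φ ⟨(0, n), by simp⟩
      ⟨1, SetLike.GradedOne.one_mem⟩) hxy

lemma isShortExact_quotπ {X Y : GrMod 𝒜} (f : X ⟶ Y) (hf : ∀ n, Function.Injective (f.app n)) :
    IsShortExact f (quotπ Y _ (isSub_range f)) where
  injective := hf
  surjective _ := QuotientAddGroup.mk'_surjective _
  comp n x := congrArg (fun φ => Hom.app φ n x) (comp_quotπ f)
  exact n y hy := (QuotientAddGroup.eq_zero_iff (N := (f.app n).range) y).1 hy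

lemma IsBoundedAbove.of_surjective {X Y : GrMod 𝒜} (f : X ⟶ Y)
    (hf : ∀ n, Function.Surjective (f.app n)) (hX : X.IsBoundedAbove) : Y.IsBoundedAbove := by
  obtain ⟨N, hN⟩ := hX
  refine ⟨N, fun n hn => ?_⟩
  have := hN n hn
  exact (hf n).subsingleton

/-- Every element of `X` is torsion, so any preimage of a torsion element of `Y` already lies in
`Γ(X)`. This is the one instance of right exactness of `Γ` that is needed. -/
lemma IsBoundedAbove.surjective_lcMap_zero {X Y : GrMod 𝒜} (hX : X.IsBoundedAbove) (f : X ⟶ Y)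
    (hf : ∀ n, Function.Surjective (f.app n)) (n : ℤ) :
    Function.Surjective ((lcMap 0 f).app n) := by
  intro u
  have hnat : lcMap 0 f ≫ (localCohomologyZeroIso Y).hom =
      (localCohomologyZeroIso X).hom ≫ (Γ 𝒜).map f :=
    (Γ 𝒜).rightDerivedZeroIsoSelf.hom.naturality f
  obtain ⟨x, hx⟩ := hf n ((localCohomologyZeroIso Y).hom.app n u : Y.torsion n).1
  refine ⟨(localCohomologyZeroIso X).inv.app n (⟨x, hX.torsion_eq_top n x⟩ : X.torsion n),
    iso_injective (localCohomologyZeroIso Y) n ?_⟩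
  refine (congrArg (fun φ => Hom.app φ n _) hnat).trans ?_
  exact (congrArg (((Γ 𝒜).map f).app n) (iso_inv_hom_app _ n _)).trans (Subtype.ext hx)

/-- Higher local cohomology of a module that is bounded above vanishes. -/
lemma IsBoundedAbove.subsingleton_succ {X : GrMod 𝒜} (hX : X.IsBoundedAbove) (i : ℕ) (n : ℤ) :
    Subsingleton ((localCohomology (i + 1) X).X n) := by
  induction i generalizing X with
  | zero =>
    -- Dimension shifting along `0 → X → E → E/X → 0`, all terms being bounded above. As `H^1(E) =
    -- 0`, the group `H^1(X)` is the cokernel of the surjection `H^0(E) → H^0(E/X)`.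
    obtain ⟨E, f, hE, hEb, hf⟩ := hX.exists_injective
    have h := isShortExact_quotπ f hf
    obtain ⟨δ, h₁, -, h₃, -⟩ := h.exists_exact 0
    refine subsingleton_of_forall_eq 0 fun u => ?_
    obtain ⟨v, rfl⟩ := h₁ n u (@Subsingleton.elim _
      (subsingleton_localCohomology_injective E 0 n) _ _)
    obtain ⟨w, rfl⟩ := hEb.surjective_lcMap_zero _ h.surjective n v
    exact (h₃ n _).2 ⟨w, rfl⟩
  | succ i ih =>
    obtain ⟨E, f, hE, hEb, hf⟩ := hX.exists_injective
    have h := isShortExact_quotπ f hf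
    exact h.subsingleton₁_succ (ih (hEb.of_surjective _ h.surjective))
      (subsingleton_localCohomology_injective E (i + 1) n)

/-! ### Shifts -/

/-- The shifted module `X(a)`, whose component of degree `n` is `X_{n + a}`. -/
def shift (X : GrMod 𝒜) (a : ℤ) : GrMod 𝒜 where
  X n := X.X (n + a)
  act m n k h := X.act m (n + a) (k + a) (by omega)
  one_act n h x := X.one_act (n + a) (by simp) x
  mul_act b c n m k hb ha hab r s x := X.mul_act b c (n + a) (m + a) (k + a) _ _ _ r s x

/-- The shift of a homomorphism. -/
def shiftMap {X Y : GrMod 𝒜} (f : X ⟶ Y) (a : ℤ) : X.shift a ⟶ Y.shift a where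
  app n := f.app (n + a)
  comm m n k h r x := f.comm m (n + a) (k + a) (by omega) r x

/-- The shift functor. -/
def shiftFunctor (a : ℤ) : GrMod 𝒜 ⥤ GrMod 𝒜 where
  obj X := X.shift a
  map f := shiftMap f a

instance (a : ℤ) : (shiftFunctor (𝒜 := 𝒜) a).Additive where

/-- Transport along an equality of degrees. -/
def tr (X : GrMod 𝒜) (n k : ℤ) (h : n = k) : X.X n →+ X.X k :=
  X.act 0 n k (by simpa using h) ⟨1, SetLike.GradedOne.one_mem⟩

@[simp]
lemma tr_self (X : GrMod 𝒜) (n : ℤ) (h : n = n) (x : X.X n) : X.tr n n h x = x :=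
  X.one_act n (by simp) x

lemma tr_tr (X : GrMod 𝒜) {n k l : ℤ} (h : n = k) (h' : k = l) (x : X.X n) :
    X.tr k l h' (X.tr n k h x) = X.tr n l (h.trans h') x := by
  subst h h'
  simp

lemma app_tr {X Y : GrMod 𝒜} (f : X ⟶ Y) {n k : ℤ} (h : n = k) (x : X.X n) :
    f.app k (X.tr n k h x) = Y.tr n k h (f.app n x) :=
  f.comm _ _ _ _ _ _

lemma act_tr (X : GrMod 𝒜) (m : ℕ) {n n' k k' : ℤ} (hn : n = n') (hk : k = k')
    (h : (m : ℤ) + n = k) (h' : (m : ℤ) + n' = k') (r : 𝒜 m) (x : X.X n) :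
    X.act m n' k' h' r (X.tr n n' hn x) = X.tr k k' hk (X.act m n k h r x) := by
  subst hn hk
  simp

/-- Shifting by `a` is inverse to shifting by `-a`: an extension problem into `E(a)` becomes one
into `E`. The maps `tr` account for `n - a + a` being equal to `n` only propositionally. -/
instance injective_shift (E : GrMod 𝒜) [Injective E] (a : ℤ) : Injective (E.shift a) where
  factors {X Y} g f _ := by
    let g' : X.shift (-a) ⟶ E :=
      { app := fun n => (E.tr (n + -a + a) n (by omega)).comp (g.app (n + -a))
        comm := fun m n k h r x =>
          (congrArg (E.tr (k + -a + a) k (by omega)) (g.comm m (n + -a) (k + -a) (by omega) r x)).trans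
            (E.act_tr m _ _ (by omega) h r _).symm }
    have := mono_of_injective (shiftMap f (-a)) fun n => injective_of_mono f (n + -a)
    let h' : Y.shift (-a) ⟶ E := Injective.factorThru g' (shiftMap f (-a))
    have hh' : shiftMap f (-a) ≫ h' = g' := Injective.comp_factorThru _ _
    let h : Y ⟶ E.shift a :=
      { app := fun n => (h'.app (n + a)).comp (Y.tr n (n + a + -a) (by omega))
        comm := fun m n k h r x =>
          (congrArg (h'.app (k + a)) (Y.act_tr m _ _ _ (by omega) r x).symm).trans
            (h'.comm m (n + a) (k + a) (by omega) r _) }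
    refine ⟨h, ?_⟩
    ext n x
    change h'.app (n + a) (Y.tr n (n + a + -a) _ (f.app n x)) = g.app n x
    rw [← app_tr f]
    refine (congrArg (fun φ => Hom.app φ (n + a) (X.tr n (n + a + -a) (by omega) x)) hh').trans ?_
    change E.tr (n + a + -a + a) (n + a) _ (g.app (n + a + -a) _) = _
    rw [app_tr g]
    exact (E.tr_tr (k := n + a + -a + a) (by omega) (by omega) _).trans (E.tr_self _ _ _)

/-- The shift of an injective resolution. -/
def shiftResolution {X : GrMod 𝒜} (I : InjectiveResolution X) (a : ℤ) :
    InjectiveResolution (X.shift a) :=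
  let i : X.shift a ⟶
      (((shiftFunctor a).mapHomologicalComplex (ComplexShape.up ℕ)).obj I.cocomplex).X 0 :=
    shiftMap I.aug a
  have : Mono i := mono_of_injective _ fun n => injective_of_mono I.aug (n + a)
  InjectiveResolution.ofExact
    (((shiftFunctor a).mapHomologicalComplex (ComplexShape.up ℕ)).obj I.cocomplex)
    (fun n => injective_shift (I.cocomplex.X n) a) i
    (by
      ext n x
      exact congrArg (fun φ => Hom.app φ (n + a) x) I.aug_d)
    ((exact_iff _).2 fun n x hx => (exact_iff _).1 I.exact_aug (n + a) x hx)
    fun i => (exactAt_succ_iff _ i).2 fun n x hx =>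
      (exactAt_succ_iff _ i).1 (I.cocomplex_exactAt_succ i) (n + a) x hx

lemma shiftResolution_aug {X : GrMod 𝒜} (I : InjectiveResolution X) (a : ℤ) :
    (shiftResolution I a).aug = shiftMap I.aug a := by
  have : Mono (C := GrMod 𝒜) (Y := (((shiftFunctor a).mapHomologicalComplex
      (ComplexShape.up ℕ)).obj I.cocomplex).X 0) (shiftMap I.aug a) :=
    mono_of_injective _ fun n => injective_of_mono I.aug (n + a)
  unfold shiftResolution
  exact InjectiveResolution.ofExact_aug _ _ _ _ _ _

lemma mem_torsion_shift_iff (X : GrMod 𝒜) (a n : ℤ) (x : X.X (n + a)) :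
    x ∈ (X.shift a).torsion n ↔ x ∈ X.torsion (n + a) := by
  constructor
  · rintro ⟨t₀, ht₀⟩
    refine ⟨t₀, fun t ht k h r => ?_⟩
    obtain rfl : k = t + n + a := by omega
    exact ht₀ t ht (t + n) rfl r
  · rintro ⟨t₀, ht₀⟩
    exact ⟨t₀, fun t ht k h r => ht₀ t ht (k + a) (by omega) r⟩

/-! ### Local cohomology through injective resolutions: shifts, torsion, multiplication -/

/-- The isomorphism computing local cohomology from an injective resolution. -/
def lcIso {X : GrMod 𝒜} (I : InjectiveResolution X) (i : ℕ) :
    localCohomology i X ≅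
      (((Γ 𝒜).mapHomologicalComplex (ComplexShape.up ℕ)).obj I.cocomplex).homology i :=
  I.isoRightDerivedObj (Γ 𝒜) i

/-- Vanishing of local cohomology in terms of an injective resolution. -/
lemma subsingleton_iff_of_resolution {X : GrMod 𝒜} (I : InjectiveResolution X) (i : ℕ) (n : ℤ) :
    Subsingleton ((localCohomology i X).X n) ↔
      ∀ z ∈ (I.cocomplex.X i).torsion n, (I.cocomplex.d i (i + 1)).app n z = 0 →
        ∃ (j : ℕ), ∃ y ∈ (I.cocomplex.X j).torsion n, (I.cocomplex.d j i).app n y = z := by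
  constructor
  · intro h z hz hdz
    have := subsingleton_of_iso (lcIso I i) h
    obtain ⟨u, hu⟩ := exists_isClass_of_cocycle
      (K := ((Γ 𝒜).mapHomologicalComplex (ComplexShape.up ℕ)).obj I.cocomplex)
      (⟨z, hz⟩ : (I.cocomplex.X i).torsion n) (Subtype.ext hdz)
    obtain ⟨j, y, hy⟩ := hu.eq_zero_iff.1 (Subsingleton.elim _ _)
    exact ⟨j, _, Subtype.prop (p := fun y => y ∈ (I.cocomplex.X j).torsion n) y,
      congrArg Subtype.val hy⟩
  · intro h
    refine subsingleton_of_iso (lcIso I i).symm (subsingleton_of_forall_eq 0 fun u => ?_)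
    obtain ⟨z, hz⟩ := exists_isClass u
    obtain ⟨j, y, hy, hyz⟩ := h _ (Subtype.prop (p := fun y => y ∈ (I.cocomplex.X i).torsion n) z)
      (congrArg Subtype.val (hz.d_eq_zero (i + 1)))
    exact hz.eq_zero_iff.2 ⟨j, (⟨y, hy⟩ : (I.cocomplex.X j).torsion n), Subtype.ext hyz⟩

/-- On a resolution and its shift both sides become the same condition on torsion cocycles. Only
vanishing is compared, so no natural isomorphism between `H^i(X(a))` and `H^i(X)(a)` has to be
built. -/
lemma subsingleton_shift_iff {X : GrMod 𝒜} {i : ℕ} {a n : ℤ} :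
    Subsingleton ((localCohomology i (X.shift a)).X n) ↔
      Subsingleton ((localCohomology i X).X (n + a)) := by
  let I : InjectiveResolution X := InjectiveResolution.of X
  rw [subsingleton_iff_of_resolution (shiftResolution I a), subsingleton_iff_of_resolution I]
  constructor
  · intro h z hz hdz
    obtain ⟨j, y, hy, hyz⟩ := h z ((mem_torsion_shift_iff _ a n z).2 hz) hdz
    exact ⟨j, y, (mem_torsion_shift_iff _ a n y).1 hy, hyz⟩
  · intro h z hz hdz
    obtain ⟨j, y, hy, hyz⟩ := h z ((mem_torsion_shift_iff _ a n z).1 hz) hdz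
    exact ⟨j, y, (mem_torsion_shift_iff _ a n y).2 hy, hyz⟩

/-- Every element of local cohomology is annihilated by all elements of large degree. -/
lemma mem_torsion_localCohomology (X : GrMod 𝒜) (i : ℕ) (n : ℤ)
    (u : (localCohomology i X).X n) : u ∈ (localCohomology i X).torsion n := by
  let I : InjectiveResolution X := InjectiveResolution.of X
  -- A representing cocycle lies in `Γ` of a term of the resolution, so some `t₀` works for it, and
  -- the same `t₀` works for its class.
  obtain ⟨z, hz⟩ := exists_isClass ((lcIso I i).hom.app n u)
  obtain ⟨t₀, ht₀⟩ := Subtype.prop (p := fun y => y ∈ (I.cocomplex.X i).torsion n) z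
  refine ⟨t₀, fun t ht k h r => ?_⟩
  have h0 : (lcIso I i).hom.app k ((localCohomology i X).act t n k h r u) = 0 := by
    rw [Hom.comm, (hz.act t k h r).eq_zero_iff]
    refine ⟨i, 0, ?_⟩
    rw [map_zero]
    exact Subtype.ext (ht₀ t ht k h r).symm
  exact iso_injective (lcIso I i) k (h0.trans (map_zero _).symm)

lemma act_comm (X : GrMod 𝒜) (a b : ℕ) (n m m' k : ℤ) (hb : (b : ℤ) + n = m) (ha : (a : ℤ) + m = k)
    (ha' : (a : ℤ) + n = m') (hb' : (b : ℤ) + m' = k) (r : 𝒜 a) (s : 𝒜 b) (y : X.X n) :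
    X.act a m k ha r (X.act b n m hb s y) = X.act b m' k hb' s (X.act a n m' ha' r y) := by
  rw [← X.mul_act a b n m k hb ha (by push_cast; omega),
    ← X.mul_act b a n m' k ha' hb' (by push_cast; omega)]
  have key : ∀ (d e : ℕ) (hde : d = e) (h₁ : (d : ℤ) + n = k) (h₂ : (e : ℤ) + n = k)
      (a : 𝒜 d) (b : 𝒜 e), (a : R) = b → X.act d n k h₁ a y = X.act e n k h₂ b y := by
    rintro d e rfl h₁ h₂ a b hab
    rw [Subtype.ext hab]
  exact key _ _ (add_comm a b) _ _ _ _ (mul_comm _ _)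

/-- Multiplication by an element of degree one. -/
def mulHom (X : GrMod 𝒜) (x : 𝒜 1) : X ⟶ X.shift 1 where
  app n := X.act 1 n (n + 1) (by push_cast; ring) x
  comm m n k h r y := X.act_comm 1 m n k (n + 1) (k + 1) h _ _ (by omega) x r y

/-- An element of local cohomology annihilated by `x` is annihilated by the homomorphism induced
by multiplication by `x`. -/
lemma lcMap_mulHom_eq_zero (X : GrMod 𝒜) (x : 𝒜 1) {i : ℕ} {n : ℤ}
    (u : (localCohomology i X).X n)
    (hu : (localCohomology i X).act 1 n (n + 1) (by push_cast; ring) x u = 0) :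
    (lcMap i (X.mulHom x)).app n u = 0 := by
  let I : InjectiveResolution X := InjectiveResolution.of X
  -- Multiplication by `x` on every term of the resolution lifts multiplication by `x` on `X`, so it
  -- computes the induced map on representing cocycles.
  let φ : I.cocomplex ⟶ (shiftResolution I 1).cocomplex :=
    { f := fun j => (I.cocomplex.X j).mulHom x
      comm' := fun j k _ => by
        ext n z
        exact (I.cocomplex.d j k).comm 1 n (n + 1) (by push_cast; ring) x z }
  have hφ : I.aug ≫ φ.f 0 = X.mulHom x ≫ (shiftResolution I 1).aug := by
    rw [shiftResolution_aug]
    ext n z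
    exact (I.aug.comm 1 n (n + 1) (by push_cast; ring) x z).symm
  have hnat : lcMap i (X.mulHom x) ≫ (lcIso (shiftResolution I 1) i).hom =
      (lcIso I i).hom ≫ HomologicalComplex.homologyMap
        (((Γ 𝒜).mapHomologicalComplex (ComplexShape.up ℕ)).map φ) i :=
    InjectiveResolution.isoRightDerivedObj_hom_naturality _ I _ φ hφ (Γ 𝒜) i
  obtain ⟨z, hz⟩ := exists_isClass ((lcIso I i).hom.app n u)
  have h₁ : (lcIso I i).hom.app (n + 1)
      ((localCohomology i X).act 1 n (n + 1) (by push_cast; ring) x u) = 0 := by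
    rw [hu, map_zero]
  rw [Hom.comm, (hz.act 1 (n + 1) (by push_cast; ring) x).eq_zero_iff] at h₁
  obtain ⟨j, y, hy⟩ := h₁
  have h₂ : (lcIso (shiftResolution I 1) i).hom.app n ((lcMap i (X.mulHom x)).app n u) = 0 := by
    refine (congrArg (fun φ => Hom.app φ n u) hnat).trans ?_
    -- The torsion primitive `y` of `x z`, of degree `n + 1`, is reread as a torsion element of
    -- degree `n` of the shift.
    refine (hz.map _).eq_zero_iff.2 ⟨j, (⟨_, (mem_torsion_shift_iff _ 1 n _).2
      (Subtype.prop (p := fun y => y ∈ (I.cocomplex.X j).torsion (n + 1)) y)⟩ :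
        ((I.cocomplex.X j).shift 1).torsion n), ?_⟩
    have hy' := congrArg Subtype.val hy
    exact Subtype.ext hy'
  exact iso_injective (lcIso (shiftResolution I 1) i) n (h₂.trans (map_zero _).symm)

end GrMod

/-! ### Complexes with bounded cohomology and the transfer of vanishing -/

namespace GrMod

variable {R : Type u} [CommRing R] {𝒜 : ℕ → AddSubgroup R} [GradedRing 𝒜]

lemma isShortExact_subι {X Y : GrMod 𝒜} (g : X ⟶ Y) (hg : ∀ n, Function.Surjective (g.app n)) :
    IsShortExact (subι X _ (isSub_ker g)) g where
  injective _ := Subtype.val_injective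
  surjective := hg
  comp n x := congrArg (fun φ => Hom.app φ n x) (subι_comp g)
  exact n y hy := ⟨(⟨y, hy⟩ : (g.app n).ker), rfl⟩

/-- If an element of a torsion module vanishes as soon as it is annihilated by some given elements
of degree one, then the module vanishes. -/
lemma subsingleton_of_torsion (X : GrMod 𝒜) (hX : ∀ n x, x ∈ X.torsion n) (l : List (𝒜 1)) (N : ℤ)
    (h : ∀ n, N < n → ∀ u : X.X n,
      (∀ x ∈ l, X.act 1 n (n + 1) (by push_cast; ring) x u = 0) → u = 0)
    (n : ℤ) (hn : N < n) : Subsingleton (X.X n) := by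
  -- Induction on the annihilation bound: if `R_t u = 0` for `t ≥ t₀ + 1`, then each `x u` has bound
  -- `t₀` in degree `n + 1 > N`, hence is zero, and the hypothesis applies to `u`.
  have key : ∀ (t₀ : ℕ) (n : ℤ), N < n → ∀ u : X.X n, (∀ (t : ℕ), t₀ ≤ t → ∀ (k : ℤ)
      (h : (t : ℤ) + n = k) (r : 𝒜 t), X.act t n k h r u = 0) → u = 0 := by
    intro t₀
    induction t₀ with
    | zero =>
      intro n _ u hu
      rw [← X.one_act n (by simp) u]
      exact hu 0 le_rfl n (by simp) _
    | succ t₀ ih =>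
      intro n hn u hu
      refine h n hn u fun x _ => ih (n + 1) (by omega) _ fun t ht k hk r => ?_
      rw [← X.mul_act t 1 n (n + 1) k (by push_cast; ring) hk (by push_cast; omega)]
      exact hu (t + 1) (by omega) k _ _
  refine subsingleton_of_forall_eq 0 fun u => ?_
  obtain ⟨t₀, ht₀⟩ := hX n u
  exact key t₀ n hn u ht₀

variable (𝒜) in
/-- Sequences of graded modules and homomorphisms with vanishing consecutive compositions. -/
structure Cx where
  /-- the terms -/
  X : ℕ → GrMod 𝒜
  /-- the differentials -/
  d : ∀ p, X p ⟶ X (p + 1)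
  d_comp : ∀ p, d p ≫ d (p + 1) = 0

namespace Cx

variable (C : Cx 𝒜)

lemma d_d (p : ℕ) (n : ℤ) (x : (C.X p).X n) : (C.d (p + 1)).app n ((C.d p).app n x) = 0 :=
  congrArg (fun φ => Hom.app φ n x) (C.d_comp p)

/-- The boundaries. -/
def bdry : ∀ (p : ℕ) (n : ℤ), AddSubgroup ((C.X p).X n)
  | 0, _ => ⊥
  | p + 1, n => ((C.d p).app n).range

lemma isSub_bdry : ∀ p, (C.X p).IsSub (C.bdry p)
  | 0 => by
    rintro m n k h r x hx
    rw [AddSubgroup.mem_bot.1 (show x ∈ (⊥ : AddSubgroup _) from hx), map_zero]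
    exact zero_mem _
  | p + 1 => isSub_range (C.d p)

lemma d_eq_zero_of_mem_bdry : ∀ (p : ℕ) (n : ℤ) (x : (C.X p).X n), x ∈ C.bdry p n →
    (C.d p).app n x = 0
  | 0, _, x, hx => by
    rw [AddSubgroup.mem_bot.1 (show x ∈ (⊥ : AddSubgroup _) from hx), map_zero]
  | p + 1, n, _, ⟨y, hy⟩ => by
    rw [← hy]
    exact C.d_d p n y

/-- The graded module of boundaries. -/
def B (p : ℕ) : GrMod 𝒜 := (C.X p).sub (C.bdry p) (C.isSub_bdry p)

/-- The graded module of cocycles. -/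
def Z (p : ℕ) : GrMod 𝒜 := (C.X p).sub _ (isSub_ker (C.d p))

/-- The quotient by the boundaries. -/
def D (p : ℕ) : GrMod 𝒜 := (C.X p).quot (C.bdry p) (C.isSub_bdry p)

/-- The differential as a homomorphism onto the boundaries. -/
def toB (p : ℕ) : C.X p ⟶ C.B (p + 1) :=
  subLift (C.bdry (p + 1)) (C.isSub_bdry (p + 1)) (C.d p) fun _ y => ⟨y, rfl⟩

/-- The inclusion of the boundaries. -/
def Bι (p : ℕ) : C.B p ⟶ C.X p := subι _ (C.bdry p) (C.isSub_bdry p)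

lemma toB_comp (p : ℕ) : C.toB p ≫ C.Bι (p + 1) = C.d p := by
  ext n x
  rfl

lemma toB_surjective (p : ℕ) (n : ℤ) : Function.Surjective ((C.toB p).app n) := by
  rintro ⟨_, y, rfl⟩
  exact ⟨y, rfl⟩

/-- The inclusion of the boundaries into the cocycles. -/
def BtoZ (p : ℕ) : C.B p ⟶ C.Z p :=
  subLift _ (isSub_ker (C.d p)) (subι _ (C.bdry p) (C.isSub_bdry p))
    fun n y => C.d_eq_zero_of_mem_bdry p n _ y.2

lemma BtoZ_injective (p : ℕ) (n : ℤ) : Function.Injective ((C.BtoZ p).app n) := fun _ _ h =>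
  Subtype.ext (congrArg (fun z : ((C.d p).app n).ker => (z : (C.X p).X n)) h)

/-- The differential on the quotient by the boundaries. -/
def DtoB (p : ℕ) : C.D p ⟶ C.B (p + 1) :=
  quotDesc _ _ (C.toB p) fun n x hx => Subtype.ext (C.d_eq_zero_of_mem_bdry p n x hx)

lemma DtoB_surjective (p : ℕ) (n : ℤ) : Function.Surjective ((C.DtoB p).app n) := by
  intro y
  obtain ⟨x, hx⟩ := C.toB_surjective p n y
  exact ⟨QuotientAddGroup.mk' _ x, hx⟩

lemma isShortExact_Z (p : ℕ) : IsShortExact (subι _ _ (isSub_ker (C.d p))) (C.toB p) where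
  injective _ := Subtype.val_injective
  surjective := C.toB_surjective p
  comp n x := Subtype.ext (congrArg (fun φ => Hom.app φ n x) (subι_comp (C.d p)))
  exact n y hy := ⟨(⟨y, congrArg Subtype.val hy⟩ : ((C.d p).app n).ker), rfl⟩

lemma isShortExact_B (p : ℕ) : IsShortExact (C.Bι p)
    (quotπ _ (C.bdry p) (C.isSub_bdry p)) where
  injective _ := Subtype.val_injective
  surjective _ := QuotientAddGroup.mk'_surjective _
  comp n x := (QuotientAddGroup.eq_zero_iff (N := C.bdry p n) _).2 x.2
  exact n y hy := ⟨(⟨y, (QuotientAddGroup.eq_zero_iff (N := C.bdry p n) y).1 hy⟩ : C.bdry p n), rfl⟩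

/-- The cohomology in position `p` vanishes in degrees greater than `N`. -/
def CohomologyBoundedBy (p : ℕ) (N : ℤ) : Prop :=
  ∀ n, N < n → ∀ z : (C.X p).X n, (C.d p).app n z = 0 → z ∈ C.bdry p n

variable {C}

/-- The cohomology in position `p` enters in two guises, as the cokernel of `B p → Z p` here and as
the kernel of `D p → B (p + 1)` in the next lemma. -/
lemma CohomologyBoundedBy.subsingleton_Z_quot {p : ℕ} {N : ℤ} (h : C.CohomologyBoundedBy p N)
    {n : ℤ} (hn : N < n) : Subsingleton (((C.Z p).quot _ (isSub_range (C.BtoZ p))).X n) := by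
  refine subsingleton_of_forall_eq 0 fun u => ?_
  induction u using QuotientAddGroup.induction_on with
  | H z =>
    exact (QuotientAddGroup.eq_zero_iff (N := ((C.BtoZ p).app n).range) z).2
      ⟨(⟨z.1, h n hn z.1 z.2⟩ : C.bdry p n), Subtype.ext rfl⟩

lemma CohomologyBoundedBy.subsingleton_ker_DtoB {p : ℕ} {N : ℤ} (h : C.CohomologyBoundedBy p N)
    {n : ℤ} (hn : N < n) : Subsingleton (((C.D p).sub _ (isSub_ker (C.DtoB p))).X n) := by
  refine subsingleton_of_forall_eq 0 ?_
  rintro ⟨u, hu⟩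
  obtain ⟨z, rfl⟩ := QuotientAddGroup.mk'_surjective _ u
  exact Subtype.ext ((QuotientAddGroup.eq_zero_iff z).2 (h n hn z (congrArg Subtype.val hu)))

/-- Vanishing of the local cohomology of the terms on a line gives vanishing of the local
cohomology of the boundaries. -/
lemma subsingleton_B (hC : ∀ p, ∃ N, C.CohomologyBoundedBy p N) (w : ℤ)
    (h : ∀ (i p : ℕ) (n : ℤ), (i : ℤ) + p + n = w → Subsingleton ((localCohomology i (C.X p)).X n))
    (p i : ℕ) (n : ℤ) (hw : (i : ℤ) + p + n = w + 1) :
    Subsingleton ((localCohomology i (C.B p)).X n) := by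
  induction p generalizing i n with
  | zero =>
    have hs : ∀ n, Subsingleton ((C.B 0).X n) := fun n =>
      subsingleton_of_forall_eq 0 fun x => Subtype.ext (AddSubgroup.mem_bot.1 x.2)
    cases i with
    | zero => exact subsingleton_localCohomology_zero (hs n)
    | succ i => exact IsBoundedAbove.subsingleton_succ ⟨0, fun n _ => hs n⟩ i n
  | succ p ih =>
    obtain ⟨N, hN⟩ := hC p
    -- `H^i(B (p + 1))_n` lies between `H^i(X p)_n`, on the line `w`, and `H^{i+1}(Z p)_n`. The
    -- latter is a quotient of `H^{i+1}(B p)_n`, covered by induction, because `Z p / B p` is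
    -- bounded above and `i + 1 > 0`.
    refine (C.isShortExact_Z p).subsingleton₃ (h i p n (by push_cast at hw; omega)) ?_
    exact (isShortExact_quotπ (C.BtoZ p) (C.BtoZ_injective p)).subsingleton₂
      (ih (i + 1) n (by push_cast at hw ⊢; omega))
      (IsBoundedAbove.subsingleton_succ ⟨N, fun n hn => hN.subsingleton_Z_quot hn⟩ i n)

/-- Vanishing of the local cohomology on a line propagates to the next line. -/
lemma subsingleton_of_line (hC : ∀ p, ∃ N, C.CohomologyBoundedBy p N) (w : ℤ)
    (h : ∀ (i p : ℕ) (n : ℤ), (i : ℤ) + p + n = w → Subsingleton ((localCohomology i (C.X p)).X n))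
    (p : ℕ) (hb : (C.D p).IsBoundedAbove)
    (hD : ∀ n : ℤ, (p : ℤ) + n = w + 1 → Subsingleton ((C.D p).X n))
    (i : ℕ) (n : ℤ) (hw : (i : ℤ) + p + n = w + 1) :
    Subsingleton ((localCohomology i (C.X p)).X n) := by
  refine (C.isShortExact_B p).subsingleton₂ (subsingleton_B hC w h p i n hw) ?_
  cases i with
  | zero => exact subsingleton_localCohomology_zero (hD n (by push_cast at hw; omega))
  | succ i => exact hb.subsingleton_succ i n

/-- As `D p` is bounded above, its component is its own `H^0`, which lies between `H^0(X p)_n` and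
`H^1(B p)_n`. The former is on the line `w` for the terms, the latter on the line `w + 1` for the
boundaries. -/
lemma subsingleton_D (hC : ∀ p, ∃ N, C.CohomologyBoundedBy p N) (w : ℤ)
    (h : ∀ (i p : ℕ) (n : ℤ), (i : ℤ) + p + n = w → Subsingleton ((localCohomology i (C.X p)).X n))
    (p : ℕ) (hb : (C.D p).IsBoundedAbove) (n : ℤ) (hw : (p : ℤ) + n = w) :
    Subsingleton ((C.D p).X n) :=
  (hb.subsingleton_iff n).1 ((C.isShortExact_B p).subsingleton₃
    (h 0 p n (by push_cast; omega)) (subsingleton_B hC w h p 1 n (by push_cast; omega)))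

/-- Vanishing of the local cohomology of the initial term from bounds on the cohomology of a
complex that is built from shifts of this term. -/
lemma subsingleton_initial (t : ℤ) (hC : ∀ p : ℕ, C.CohomologyBoundedBy p (t - p))
    (hX : ∀ (i p : ℕ) (n : ℤ), Subsingleton ((localCohomology i (C.X 0)).X (n + p)) →
      Subsingleton ((localCohomology i (C.X p)).X n))
    (l : List (𝒜 1))
    (hl : ∀ (i : ℕ) (n : ℤ) (u : (localCohomology i (C.X 0)).X n),
      (∀ x ∈ l, (localCohomology i (C.X 0)).act 1 n (n + 1) (by push_cast; ring) x u = 0) →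
        (lcMap i (C.d 0)).app n u = 0)
    (i : ℕ) (n : ℤ) (hn : t < i + n) : Subsingleton ((localCohomology i (C.X 0)).X n) := by
  induction i using Nat.strong_induction_on generalizing n with
  | _ i ih =>
  have hXp : ∀ (j p : ℕ) (m : ℤ), j < i → t < j + p + m →
      Subsingleton ((localCohomology j (C.X p)).X m) := fun j p m hj hm =>
    hX j p m (ih j hj (m + p) (by omega))
  -- The kernel of `D p → B (p + 1)` is the cohomology in position `p`: the bound `t - p` settles `j
  -- = 0`, and acyclicity of modules bounded above settles `j > 0`.
  have hH : ∀ (j p : ℕ) (m : ℤ), t < j + p + m →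
      Subsingleton ((localCohomology j ((C.D p).sub _ (isSub_ker (C.DtoB p)))).X m) := by
    intro j p m hm
    cases j with
    | zero =>
      exact subsingleton_localCohomology_zero
        ((hC p).subsingleton_ker_DtoB (by push_cast at hm; omega))
    | succ j =>
      exact IsBoundedAbove.subsingleton_succ ⟨_, fun n hn => (hC p).subsingleton_ker_DtoB hn⟩ j m
  -- Lowering `j` by one while raising `p` by one preserves `j + p + m`. Hence `H^j(D p)` reduces,
  -- through `B (p + 1)`, to `H^{j-1}(D (p + 1))` and to terms known from the outer induction, since
  -- `j < i`.
  have hD : ∀ (j p : ℕ) (m : ℤ), j < i → t < j + p + m →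
      Subsingleton ((localCohomology j (C.D p)).X m) := by
    intro j
    induction j with
    | zero =>
      intro p m hj hm
      refine (isShortExact_subι (C.DtoB p) (C.DtoB_surjective p)).subsingleton₂ (hH 0 p m hm) ?_
      exact (C.isShortExact_B (p + 1)).subsingleton₁_zero
        (hXp 0 (p + 1) m hj (by push_cast at hm ⊢; omega))
    | succ j ihj =>
      intro p m hj hm
      refine (isShortExact_subι (C.DtoB p) (C.DtoB_surjective p)).subsingleton₂ (hH _ p m hm) ?_
      exact (C.isShortExact_B (p + 1)).subsingleton₁_succ
        (ihj (p + 1) m (by omega) (by push_cast at hm ⊢; omega))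
        (hXp (j + 1) (p + 1) m hj (by push_cast at hm ⊢; omega))
  have hZ : ∀ m : ℤ, t < i + m → Subsingleton ((localCohomology i (C.Z 0)).X m) := by
    have hZ0 : ∀ m : ℤ, t < m → Subsingleton ((C.Z 0).X m) := fun m hm =>
      subsingleton_of_forall_eq 0 fun z => Subtype.ext (AddSubgroup.mem_bot.1
        (hC 0 m (by push_cast; omega) z.1 z.2))
    intro m hm
    cases i with
    | zero => exact subsingleton_localCohomology_zero (hZ0 m (by push_cast at hm; omega))
    | succ i => exact IsBoundedAbove.subsingleton_succ ⟨t, hZ0⟩ i m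
  -- The differential factors as `X 0 → B 1 → X 1`. The first map is injective on `H^i` because of
  -- `hZ`, the second because `H^{i-1}(D 1)` vanishes, or by left exactness if `i = 0`.
  have hinj : ∀ m : ℤ, t < i + m → Function.Injective ((lcMap i (C.d 0)).app m) := by
    intro m hm
    have h₁ := (C.isShortExact_Z 0).injective_lcMap_right (hZ m hm)
    have h₂ : Function.Injective
        ((lcMap i (C.Bι 1)).app m) := by
      cases i with
      | zero => exact (C.isShortExact_B 1).injective_lcMap_zero m
      | succ i =>
        exact (C.isShortExact_B 1).injective_lcMap_succ
          (hD i 1 m (by omega) (by push_cast at hm ⊢; omega))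
    rw [← C.toB_comp 0, lcMap_comp]
    intro a b hab
    exact h₁ (h₂ hab)
  -- By `hl` and injectivity, an element killed by all of `l` in a degree above `t - i` is zero; as
  -- `H^i(X 0)` is torsion, this forces it to vanish there.
  refine subsingleton_of_torsion _ (mem_torsion_localCohomology (C.X 0) i) l (t - i) ?_ n (by omega)
  intro m hm u hu
  exact (injective_iff_map_eq_zero _).1 (hinj m (by omega)) u (hl i m u hu)

end Cx
end GrMod

namespace GrMod

variable {R : Type u} [CommRing R] {𝒜 : ℕ → AddSubgroup R} [GradedRing 𝒜]

/-! ### Products -/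

section prod

variable {X Y Z : GrMod 𝒜}

/-- The first projection. -/
def prodFst (X Y : GrMod 𝒜) : X.prod Y ⟶ X := (prodBicone X Y).fst

/-- The second projection. -/
def prodSnd (X Y : GrMod 𝒜) : X.prod Y ⟶ Y := (prodBicone X Y).snd

/-- The second inclusion. -/
def prodInr (X Y : GrMod 𝒜) : Y ⟶ X.prod Y := (prodBicone X Y).inr

/-- The homomorphism into a direct sum with given components. -/
def prodLift (f : Z ⟶ X) (g : Z ⟶ Y) : Z ⟶ X.prod Y where
  app n := (f.app n).prod (g.app n)
  comm m n k h r z := Prod.ext (f.comm m n k h r z) (g.comm m n k h r z)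

lemma isShortExact_prod (X Y : GrMod 𝒜) : IsShortExact (prodInr X Y) (prodFst X Y) where
  injective _ _ _ h := congrArg Prod.snd h
  surjective n a := ⟨((a, 0) : X.X n × Y.X n), rfl⟩
  comp _ _ := rfl
  exact n y hy := ⟨(y : X.X n × Y.X n).2, Prod.ext hy.symm rfl⟩

/-- Additivity of `H^i`: a class whose first component vanishes comes from `H^i(Y)`, where the
second projection recovers it. -/
lemma lcMap_prodLift_eq_zero (f : Z ⟶ X) (g : Z ⟶ Y) {i : ℕ} {n : ℤ}
    (u : (localCohomology i Z).X n) (hf : (lcMap i f).app n u = 0)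
    (hg : (lcMap i g).app n u = 0) : (lcMap i (prodLift f g)).app n u = 0 := by
  obtain ⟨-, -, h, -⟩ := (isShortExact_prod X Y).exists_exact i
  obtain ⟨v, hv⟩ := h n ((lcMap i (prodLift f g)).app n u)
    ((congrArg (fun φ => Hom.app φ n u) (lcMap_comp i (prodLift f g) (prodFst X Y))).symm.trans hf)
  have h₁ : (lcMap i (prodSnd X Y)).app n ((lcMap i (prodInr X Y)).app n v) = v := by
    refine (congrArg (fun φ => Hom.app φ n v) (lcMap_comp i (prodInr X Y) (prodSnd X Y))).symm.trans ?_
    exact congrArg (fun φ => Hom.app φ n v) (((Γ 𝒜).rightDerived i).map_id Y)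
  have h₂ : (lcMap i (prodSnd X Y)).app n ((lcMap i (prodLift f g)).app n u) = 0 :=
    (congrArg (fun φ => Hom.app φ n u) (lcMap_comp i (prodLift f g) (prodSnd X Y))).symm.trans hg
  rw [← hv, h₁] at h₂
  rw [← hv, h₂, map_zero]

end prod

/-! ### Generation in consecutive degrees -/

/-- The subgroup of the component of degree `k = m + 1` generated by the multiples of a subgroup of
the component of degree `m` by given elements of degree one. -/
def genBy (X : GrMod 𝒜) (m k : ℤ) (h : ((1 : ℕ) : ℤ) + m = k) (N : AddSubgroup (X.X m)) :
    List (𝒜 1) → AddSubgroup (X.X k)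
  | [] => ⊥
  | x :: l => N.map (X.act 1 m k h x) ⊔ genBy X m k h N l

lemma genBy_map {X Y : GrMod 𝒜} (f : X ⟶ Y) (m k : ℤ) (h : ((1 : ℕ) : ℤ) + m = k)
    (N : AddSubgroup (X.X m)) (l : List (𝒜 1)) :
    (genBy X m k h N l).map (f.app k) = genBy Y m k h (N.map (f.app m)) l := by
  induction l with
  | nil => exact AddSubgroup.map_bot _
  | cons x l ih =>
    rw [genBy, genBy, AddSubgroup.map_sup, ih, AddSubgroup.map_map, AddSubgroup.map_map]
    congr 2
    ext y
    exact f.comm 1 m k h x y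

lemma genBy_mono {X : GrMod 𝒜} {m k : ℤ} {h : ((1 : ℕ) : ℤ) + m = k}
    {N N' : AddSubgroup (X.X m)} (hN : N ≤ N') (l : List (𝒜 1)) :
    genBy X m k h N l ≤ genBy X m k h N' l := by
  induction l with
  | nil => exact le_rfl
  | cons x l ih => exact sup_le_sup (AddSubgroup.map_mono hN) ih

lemma genBy_le {X : GrMod 𝒜} {N : ∀ n, AddSubgroup (X.X n)} (hN : X.IsSub N) {m k : ℤ}
    (h : ((1 : ℕ) : ℤ) + m = k) (l : List (𝒜 1)) : genBy X m k h (N m) l ≤ N k := by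
  induction l with
  | nil => exact bot_le
  | cons x l ih =>
    refine sup_le ?_ ih
    rintro _ ⟨y, hy, rfl⟩
    exact hN 1 m k h x y hy

lemma genBy_le_of_forall {X : GrMod 𝒜} {m k : ℤ} {h : ((1 : ℕ) : ℤ) + m = k}
    {N : AddSubgroup (X.X m)} {N' : AddSubgroup (X.X k)} {l : List (𝒜 1)}
    (hN : ∀ x ∈ l, ∀ y ∈ N, X.act 1 m k h x y ∈ N') : genBy X m k h N l ≤ N' := by
  induction l with
  | nil => exact bot_le
  | cons x l ih =>
    refine sup_le ?_ (ih fun y hy => hN y (List.mem_cons_of_mem _ hy))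
    rintro _ ⟨y, hy, rfl⟩
    exact hN x List.mem_cons_self y hy

lemma act_mem_genBy {X : GrMod 𝒜} {m k : ℤ} {h : ((1 : ℕ) : ℤ) + m = k}
    {N : AddSubgroup (X.X m)} {l : List (𝒜 1)} {x : 𝒜 1} (hx : x ∈ l) {y : X.X m} (hy : y ∈ N) :
    X.act 1 m k h x y ∈ genBy X m k h N l := by
  induction l with
  | nil => simp at hx
  | cons x' l ih =>
    obtain rfl | hx := List.mem_cons.1 hx
    · exact (le_sup_left : _ ≤ genBy X m k h N (x :: l)) ⟨y, hy, rfl⟩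
    · exact (le_sup_right : _ ≤ genBy X m k h N (x' :: l)) (ih hx)

/-- Every graded submodule is generated, from some degree on, by its component in the previous
degree and the elements of degree one in `l`. -/
def EventuallyGenerated (l : List (𝒜 1)) (X : GrMod 𝒜) : Prop :=
  ∀ N : ∀ n, AddSubgroup (X.X n), X.IsSub N → ∃ m₀ : ℤ, ∀ (m k : ℤ) (h : ((1 : ℕ) : ℤ) + m = k),
    m₀ ≤ m → N k ≤ genBy X m k h (N m) l

/-- The classical argument that an extension of Noetherian modules is Noetherian, one degree at a
time. With stability under shifts it carries the property from `M` to every term of the Koszul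
complex. -/
lemma EventuallyGenerated.of_isShortExact {l : List (𝒜 1)} {X Y Z : GrMod 𝒜} {f : X ⟶ Y}
    {g : Y ⟶ Z} (h : IsShortExact f g) (hX : EventuallyGenerated l X)
    (hZ : EventuallyGenerated l Z) : EventuallyGenerated l Y := by
  intro N hN
  have h₁ : X.IsSub (fun n => (N n).comap (f.app n)) := by
    intro m n k hk r x hx
    rw [AddSubgroup.mem_comap] at hx ⊢
    rw [f.comm]
    exact hN m n k hk r _ hx
  have h₂ : Z.IsSub (fun n => (N n).map (g.app n)) := by
    rintro m n k hk r _ ⟨x, hx, rfl⟩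
    exact ⟨Y.act m n k hk r x, hN m n k hk r x hx, g.comm m n k hk r x⟩
  obtain ⟨m₁, hm₁⟩ := hX _ h₁
  obtain ⟨m₂, hm₂⟩ := hZ _ h₂
  refine ⟨max m₁ m₂, fun m k hk hm y hy => ?_⟩
  have hy₂ := hm₂ m k hk (le_of_max_le_right hm) ⟨y, hy, rfl⟩
  rw [← genBy_map] at hy₂
  obtain ⟨y', hy', hyy'⟩ := hy₂
  obtain ⟨w, hw⟩ := h.exact k (y - y') (by rw [map_sub, hyy', sub_self])
  have hw₁ : w ∈ (N k).comap (f.app k) := by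
    rw [AddSubgroup.mem_comap, hw]
    exact sub_mem hy (genBy_le hN hk l hy')
  have hw₂ : y - y' ∈ genBy Y m k hk (N m) l := by
    have := AddSubgroup.mem_map_of_mem (f.app k) (hm₁ m k hk (le_of_max_le_left hm) hw₁)
    rw [genBy_map, hw] at this
    exact genBy_mono (AddSubgroup.map_le_iff_le_comap.2 le_rfl) l this
  simpa using add_mem hw₂ hy'

lemma genBy_shift (X : GrMod 𝒜) (a m k : ℤ) (h : ((1 : ℕ) : ℤ) + m = k)
    (h' : ((1 : ℕ) : ℤ) + (m + a) = k + a) (N : AddSubgroup (X.X (m + a))) (l : List (𝒜 1)) :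
    genBy (X.shift a) m k h N l = genBy X (m + a) (k + a) h' N l := by
  induction l with
  | nil => rfl
  | cons x l ih =>
    exact congrArg (_ ⊔ ·) ih

lemma IsSub.tr_mem_iff {X : GrMod 𝒜} {N : ∀ n, AddSubgroup (X.X n)} {n k : ℤ} (h : n = k)
    (x : X.X n) : X.tr n k h x ∈ N k ↔ x ∈ N n := by
  subst h
  simp

lemma EventuallyGenerated.shift {l : List (𝒜 1)} {X : GrMod 𝒜} (hX : EventuallyGenerated l X)
    (a : ℤ) : EventuallyGenerated l (X.shift a) := by
  intro N hN
  -- The submodule `N` of `X(a)` regarded as a submodule of `X`.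
  let N' : ∀ n, AddSubgroup (X.X n) := fun n =>
    AddSubgroup.comap (G := X.X n) (N := X.X (n - a + a)) (X.tr n (n - a + a) (by omega)) (N (n - a))
  have hN' : X.IsSub N' := by
    intro m n k h r x hx
    change X.tr k (k - a + a) _ (X.act m n k h r x) ∈ N (k - a)
    rw [← X.act_tr m (show n = n - a + a by omega) (by omega) h (by omega)]
    exact hN m (n - a) (k - a) (by omega) r _ hx
  have hNN' : ∀ n, N' (n + a) = N n := by
    intro n
    ext x
    exact IsSub.tr_mem_iff (X := X.shift a) (show n = n + a - a by omega) x
  obtain ⟨m₀, hm₀⟩ := hX N' hN'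
  refine ⟨m₀ - a, fun m k h hm => ?_⟩
  have h₁ := hm₀ (m + a) (k + a) (by omega) (by omega)
  rw [hNN' k, hNN' m] at h₁
  exact h₁.trans (genBy_shift X a m k h (by omega) (N m) l).ge

lemma EventuallyGenerated.of_subsingleton {l : List (𝒜 1)} {X : GrMod 𝒜}
    (hX : ∀ n, Subsingleton (X.X n)) : EventuallyGenerated l X := by
  intro N hN
  refine ⟨0, fun m k h _ x _ => ?_⟩
  have := hX k
  rw [Subsingleton.elim x 0]
  exact zero_mem _

/-! ### The Koszul complex -/

namespace Cx

/-- The terms of the cone of the multiplication by an element of degree one. -/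
def coneX (C : Cx 𝒜) : ℕ → GrMod 𝒜
  | 0 => C.X 0
  | p + 1 => (C.X (p + 1)).prod ((C.X p).shift 1)

/-- The differentials of the cone of the multiplication by an element of degree one. -/
def coneD (C : Cx 𝒜) (x : 𝒜 1) : ∀ p, C.coneX p ⟶ C.coneX (p + 1)
  | 0 => prodLift (C.d 0) ((C.X 0).mulHom x)
  | p + 1 => prodLift (prodFst (C.X (p + 1)) ((C.X p).shift 1) ≫ C.d (p + 1))
      (prodFst (C.X (p + 1)) ((C.X p).shift 1) ≫ (C.X (p + 1)).mulHom x +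
        -(prodSnd (C.X (p + 1)) ((C.X p).shift 1) ≫ shiftMap (C.d p) 1))

/-- Multiplication by an element of degree one, as an additive map. -/
def mulX (X : GrMod 𝒜) (x : 𝒜 1) (n : ℤ) : X.X n →+ X.X (n + 1) :=
  X.act 1 n (n + 1) (by push_cast; ring) x

/-- The components of a homomorphism into a shifted module. -/
def appShift {X Y : GrMod 𝒜} (f : X ⟶ Y.shift 1) (n : ℤ) : X.X n →+ Y.X (n + 1) := f.app n

lemma app_mulX {X Y : GrMod 𝒜} (f : X ⟶ Y) (x : 𝒜 1) (n : ℤ) (a : X.X n) :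
    f.app (n + 1) (mulX X x n a) = mulX Y x n (f.app n a) :=
  f.comm _ _ _ _ _ _

lemma appShift_mulX {X Y : GrMod 𝒜} (f : X ⟶ Y.shift 1) (x : 𝒜 1) (n : ℤ) (a : X.X n) :
    appShift f (n + 1) (mulX X x n a) = mulX Y x (n + 1) (appShift f n a) :=
  f.comm _ _ _ _ _ _

/-- The (shifted) cone of the multiplication by an element of degree one. -/
def cone (C : Cx 𝒜) (x : 𝒜 1) : Cx 𝒜 where
  X := C.coneX
  d := C.coneD x
  d_comp p := by
    ext n a
    cases p with
    | zero =>
      have key : ∀ a : (C.X 0).X n, mulX (C.X 1) x n ((C.d 0).app n a) +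
          -((C.d 0).app (n + 1) (mulX (C.X 0) x n a)) = 0 := fun a => by
        rw [app_mulX (C.d 0), add_neg_cancel]
      exact Prod.ext (C.d_d 0 n a) (key a)
    | succ p =>
      obtain ⟨a, b⟩ := a
      have key : ∀ (a : (C.X (p + 1)).X n) (b : (C.X p).X (n + 1)),
          mulX (C.X (p + 2)) x n ((C.d (p + 1)).app n a) + -((C.d (p + 1)).app (n + 1)
            (mulX (C.X (p + 1)) x n a + -((C.d p).app (n + 1) b))) = 0 := fun a b => by
        rw [map_add, map_neg, C.d_d p, app_mulX (C.d (p + 1)), neg_zero, add_zero,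
          add_neg_cancel]
      exact Prod.ext (C.d_d (p + 1) n a) (key a b)

/-- Multiplication by `x` is homotopic to zero. -/
def NullHomotopic (C : Cx 𝒜) (x : 𝒜 1) : Prop :=
  ∃ s : ∀ p, C.X (p + 1) ⟶ (C.X p).shift 1,
    (∀ n (a : (C.X 0).X n), appShift (s 0) n ((C.d 0).app n a) = mulX (C.X 0) x n a) ∧
    ∀ p n (a : (C.X (p + 1)).X n), (C.d p).app (n + 1) (appShift (s p) n a) +
      appShift (s (p + 1)) n ((C.d (p + 1)).app n a) = mulX (C.X (p + 1)) x n a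

/-- For a cocycle `z` the homotopy formula reduces to `x z = d (s z)`. -/
lemma NullHomotopic.act_mem_bdry {C : Cx 𝒜} {x : 𝒜 1} (h : C.NullHomotopic x) (p : ℕ) (n k : ℤ)
    (hk : ((1 : ℕ) : ℤ) + n = k) (z : (C.X p).X n) (hz : (C.d p).app n z = 0) :
    (C.X p).act 1 n k hk x z ∈ C.bdry p k := by
  obtain rfl : k = n + 1 := by push_cast at hk; omega
  obtain ⟨s, h₀, h₁⟩ := h
  change mulX (C.X p) x n z ∈ _
  cases p with
  | zero =>
    rw [← h₀, hz, map_zero]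
    exact zero_mem _
  | succ p =>
    rw [← h₁, hz, map_zero, add_zero]
    exact ⟨_, rfl⟩

/-- The homotopy is `(a, b) ↦ (b, 0)`. The sign in the cone differential makes the two terms `d b`
cancel. -/
lemma cone_nullHomotopic_self (C : Cx 𝒜) (x : 𝒜 1) : (C.cone x).NullHomotopic x := by
  let s : ∀ p, C.coneX (p + 1) ⟶ (C.coneX p).shift 1 := fun p => match p with
    | 0 => prodSnd (C.X 1) ((C.X 0).shift 1)
    | p + 1 =>
      { app := fun n => (AddMonoidHom.inl ((C.X (p + 1)).X (n + 1)) ((C.X p).X (n + 1 + 1))).comp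
          (AddMonoidHom.snd ((C.X (p + 2)).X n) ((C.X (p + 1)).X (n + 1)))
        comm := fun m n k h r a => Prod.ext rfl
          (map_zero ((C.X p).act m (n + 1 + 1) (k + 1 + 1) (by omega) r)).symm }
  refine ⟨s, fun n a => rfl, fun p n a => ?_⟩
  obtain ⟨a, b⟩ := a
  cases p with
  | zero =>
    refine Prod.ext ?_ ?_
    · change (C.d 0).app (n + 1) b + (mulX (C.X 1) x n a + -((C.d 0).app (n + 1) b)) =
        mulX (C.X 1) x n a
      abel
    · exact add_zero (mulX (C.X 0) x (n + 1) b)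
  | succ p =>
    refine Prod.ext ?_ ?_
    · change (C.d (p + 1)).app (n + 1) b + (mulX (C.X (p + 2)) x n a +
        -((C.d (p + 1)).app (n + 1) b)) = mulX (C.X (p + 2)) x n a
      abel
    · change (mulX (C.X (p + 1)) x (n + 1) b + -((C.d p).app (n + 1 + 1) 0)) + 0 =
        mulX (C.X (p + 1)) x (n + 1) b
      rw [map_zero, neg_zero, add_zero, add_zero]

/-- The homotopy is `(s, -s)`, with the sign forced by that of the cone differential. The mixed
terms cancel because `s`, being linear, commutes with `x`. -/
lemma NullHomotopic.cone {C : Cx 𝒜} {y : 𝒜 1} (h : C.NullHomotopic y) (x : 𝒜 1) :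
    (C.cone x).NullHomotopic y := by
  obtain ⟨s, h₀, h₁⟩ := h
  let s' : ∀ p, C.coneX (p + 1) ⟶ (C.coneX p).shift 1 := fun p => match p with
    | 0 => prodFst (C.X 1) ((C.X 0).shift 1) ≫ s 0
    | p + 1 =>
      { app := fun n => AddMonoidHom.prodMap (appShift (s (p + 1)) n) (-(appShift (s p) (n + 1)))
        comm := fun m n k h r a => Prod.ext ((s (p + 1)).comm m n k h r _)
          ((congrArg (fun w => -w) ((s p).comm m (n + 1) (k + 1) (by omega) r _)).trans
            (map_neg ((C.X p).act m (n + 1 + 1) (k + 1 + 1) (by omega) r) _).symm) }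
  refine ⟨s', h₀, fun p n a => ?_⟩
  obtain ⟨a, b⟩ := a
  cases p with
  | zero =>
    have key : ∀ (a : (C.X 1).X n) (b : (C.X 0).X (n + 1)),
        mulX (C.X 0) x (n + 1) (appShift (s 0) n a) +
          -(appShift (s 0) (n + 1) (mulX (C.X 1) x n a + -((C.d 0).app (n + 1) b))) =
        mulX (C.X 0) y (n + 1) b := fun a b => by
      rw [map_add, map_neg, h₀, appShift_mulX (s 0)]
      abel
    exact Prod.ext (h₁ 0 n a) (key a b)
  | succ p =>
    have key : ∀ (a : (C.X (p + 2)).X n) (b : (C.X (p + 1)).X (n + 1)),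
        (mulX (C.X (p + 1)) x (n + 1) (appShift (s (p + 1)) n a) +
          -((C.d p).app (n + 1 + 1) (-(appShift (s p) (n + 1) b)))) +
        -(appShift (s (p + 1)) (n + 1)
          (mulX (C.X (p + 2)) x n a + -((C.d (p + 1)).app (n + 1) b))) =
        mulX (C.X (p + 1)) y (n + 1) b := fun a b => by
      rw [map_add, map_neg, map_neg, neg_neg, appShift_mulX (s (p + 1)), ← h₁ p (n + 1) b]
      abel
    exact Prod.ext (h₁ (p + 1) n a) (key a b)

/-- Meant for the last position `p` of `C`, where `X (p + 1) = 0`: the last term of the cone is then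
`(X p)(1)`, and its boundaries are the multiples of `x` plus the old boundaries. Iteration gives
`koszul_bdry_length`. -/
lemma mem_bdry_cone_succ (C : Cx 𝒜) (x : 𝒜 1) (p : ℕ) (n : ℤ)
    (hs : Subsingleton ((C.X (p + 1)).X n)) (c : (C.X (p + 1)).X n × (C.X p).X (n + 1)) :
    c ∈ (show AddSubgroup ((C.X (p + 1)).X n × (C.X p).X (n + 1)) from
      (C.cone x).bdry (p + 1) n) ↔ c.2 ∈ (mulX (C.X p) x n).range ⊔ C.bdry p (n + 1) := by
  cases p with
  | zero =>
    change _ ↔ c.2 ∈ (mulX (C.X 0) x n).range ⊔ ⊥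
    rw [sup_bot_eq]
    constructor
    · rintro ⟨a, rfl⟩
      exact ⟨a, rfl⟩
    · rintro ⟨a, ha⟩
      exact ⟨a, Prod.ext (Subsingleton.elim _ _) ha⟩
  | succ p =>
    constructor
    · rintro ⟨⟨a, b⟩, rfl⟩
      exact add_mem (AddSubgroup.mem_sup_left ⟨a, rfl⟩)
        (neg_mem (AddSubgroup.mem_sup_right ⟨b, rfl⟩))
    · intro hc
      obtain ⟨_, ⟨a, rfl⟩, _, ⟨b, rfl⟩, hab⟩ := AddSubgroup.mem_sup.1 hc
      refine ⟨((a, -b) : (C.X (p + 1)).X n × (C.X p).X (n + 1)),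
        Prod.ext (Subsingleton.elim _ _) ?_⟩
      have key : mulX (C.X (p + 1)) x n a + -((C.d p).app (n + 1) (-b)) = c.2 := by
        rw [map_neg, neg_neg, hab]
      exact key

/-- The complex concentrated in position zero. -/
def single (M : GrMod 𝒜) : Cx 𝒜 where
  X
    | 0 => M
    | _ + 1 => zeroObj
  d _ := 0
  d_comp _ := zero_comp

end Cx

/-- The Koszul (cochain) complex of a list of elements of degree one. -/
def koszul (M : GrMod 𝒜) : List (𝒜 1) → Cx 𝒜
  | [] => Cx.single M
  | x :: l => (koszul M l).cone x

section koszul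

variable (M : GrMod 𝒜)

lemma koszul_X_zero (l : List (𝒜 1)) : (koszul M l).X 0 = M := by
  induction l with
  | nil => rfl
  | cons x l ih => exact ih

lemma koszul_nullHomotopic (l : List (𝒜 1)) (x : 𝒜 1) (hx : x ∈ l) :
    (koszul M l).NullHomotopic x := by
  induction l with
  | nil => simp at hx
  | cons y l ih =>
    obtain rfl | hx := List.mem_cons.1 hx
    · exact Cx.cone_nullHomotopic_self _ _
    · exact (ih hx).cone y

lemma subsingleton_zeroObj (n : ℤ) : Subsingleton ((zeroObj : GrMod 𝒜).X n) :=
  inferInstanceAs (Subsingleton PUnit)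

lemma subsingleton_localCohomology_zeroObj (i : ℕ) (n : ℤ) :
    Subsingleton ((localCohomology i (zeroObj : GrMod 𝒜)).X n) := by
  cases i with
  | zero => exact subsingleton_localCohomology_zero (subsingleton_zeroObj n)
  | succ i => exact IsBoundedAbove.subsingleton_succ ⟨0, fun n _ => subsingleton_zeroObj n⟩ i n

lemma subsingleton_koszul_X (l : List (𝒜 1)) (p : ℕ) (hp : l.length < p) (n : ℤ) :
    Subsingleton (((koszul M l).X p).X n) := by
  induction l generalizing p n with
  | nil =>
    obtain _ | p := p
    · simp at hp
    · exact subsingleton_zeroObj n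
  | cons x l ih =>
    obtain _ | p := p
    · simp at hp
    · have := ih (p + 1) (by simp at hp; omega) n
      have := ih p (by simpa using hp) (n + 1)
      exact inferInstanceAs (Subsingleton
        (((koszul M l).X (p + 1)).X n × ((koszul M l).X p).X (n + 1)))

/-- The term in position `p` is an iterated extension of copies of `M(p)`. -/
lemma subsingleton_localCohomology_koszul (l : List (𝒜 1)) (i p : ℕ) (n : ℤ)
    (h : Subsingleton ((localCohomology i M).X (n + p))) :
    Subsingleton ((localCohomology i ((koszul M l).X p)).X n) := by
  induction l generalizing p n with
  | nil =>
    obtain _ | p := p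
    · have h' : Subsingleton ((localCohomology i M).X n) := by simpa using h
      exact h'
    · exact subsingleton_localCohomology_zeroObj i n
  | cons x l ih =>
    obtain _ | p := p
    · exact ih 0 n h
    · refine (isShortExact_prod _ _).subsingleton₂ ?_ (ih (p + 1) n h)
      refine subsingleton_shift_iff.2 (ih p (n + 1) ?_)
      rwa [show n + 1 + (p : ℤ) = n + ((p + 1 : ℕ) : ℤ) by push_cast; ring]

lemma eventuallyGenerated_koszul (l₀ l : List (𝒜 1)) (h : EventuallyGenerated l₀ M) (p : ℕ) :
    EventuallyGenerated l₀ ((koszul M l).X p) := by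
  induction l generalizing p with
  | nil =>
    obtain _ | p := p
    · exact h
    · exact .of_subsingleton subsingleton_zeroObj
  | cons x l ih =>
    obtain _ | p := p
    · exact ih 0
    · exact .of_isShortExact (isShortExact_prod _ _) ((ih p).shift 1) (ih (p + 1))

/-- The components of the first differential are the multiplications by the elements of `l`. -/
lemma lcMap_koszul_d_eq_zero (l : List (𝒜 1)) (i : ℕ) (n : ℤ)
    (u : (localCohomology i ((koszul M l).X 0)).X n)
    (hu : ∀ x ∈ l, (localCohomology i ((koszul M l).X 0)).act 1 n (n + 1) (by push_cast; ring) x u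
      = 0) : (lcMap i ((koszul M l).d 0)).app n u = 0 := by
  induction l with
  | nil =>
    have := subsingleton_localCohomology_zeroObj (𝒜 := 𝒜) i n
    exact @Subsingleton.elim _ this _ _
  | cons x l ih =>
    exact lcMap_prodLift_eq_zero _ _ u (ih u fun y hy => hu y (List.mem_cons_of_mem _ hy))
      (lcMap_mulHom_eq_zero _ x u (hu x List.mem_cons_self))

/-- In large degrees the cocycles are generated by products of elements of `l` with cocycles one
degree lower, and such products are boundaries by the null-homotopies. -/
lemma exists_cohomologyBoundedBy (l : List (𝒜 1)) (h : EventuallyGenerated l M) (p : ℕ) :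
    ∃ N, (koszul M l).CohomologyBoundedBy p N := by
  obtain ⟨m₀, hm₀⟩ := eventuallyGenerated_koszul M l l h p _ (isSub_ker ((koszul M l).d p))
  refine ⟨m₀, fun n hn z hz => ?_⟩
  refine genBy_le_of_forall ?_ (hm₀ (n - 1) n (by push_cast; ring) (by omega) hz)
  exact fun x hx y hy => (koszul_nullHomotopic M l x hx).act_mem_bdry p _ _ _ y hy

/-- Only the positions up to the length of `l` carry nonzero terms, so a maximum of finitely many
bounds suffices. -/
lemma exists_cohomologyBoundedBy_uniform (l : List (𝒜 1)) (h : EventuallyGenerated l M) :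
    ∃ t : ℤ, ∀ p : ℕ, (koszul M l).CohomologyBoundedBy p (t - p) := by
  choose N hN using exists_cohomologyBoundedBy M l h
  obtain ⟨t, ht⟩ : ∃ t : ℤ, ∀ p ∈ Finset.range (l.length + 1), N p + p ≤ t := by
    obtain ⟨t, ht⟩ := ((Finset.range (l.length + 1)).image fun p => N p + (p : ℤ)).bddAbove
    exact ⟨t, fun p hp => ht (Finset.mem_coe.2 (Finset.mem_image_of_mem _ hp))⟩
  refine ⟨t, fun p n hn z hz => ?_⟩
  by_cases hp : p ∈ Finset.range (l.length + 1)
  · exact hN p n (by have := ht p hp; omega) z hz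
  · have := subsingleton_koszul_X M l p (by simpa using hp) n
    rw [Subsingleton.elim z 0]
    exact zero_mem _

/-- The boundaries in the last term of the Koszul complex. -/
lemma koszul_bdry_length (l : List (𝒜 1)) (m k : ℤ) (h : ((1 : ℕ) : ℤ) + m = k) :
    (koszul M l).bdry l.length k = genBy ((koszul M l).X l.length) m k h ⊤ l := by
  induction l generalizing m k with
  | nil => rfl
  | cons x l ih =>
    obtain rfl : k = m + 1 := by push_cast at h; omega
    have hs := fun n => subsingleton_koszul_X M l (l.length + 1) (by simp) n
    let Y := (koszul M l).X (l.length + 1)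
    let Z := ((koszul M l).X l.length).shift 1
    have hinj : Function.Injective ((prodSnd Y Z).app (m + 1)) := fun a b hab =>
      Prod.ext (@Subsingleton.elim _ (hs (m + 1)) _ _) hab
    have htop : (⊤ : AddSubgroup ((Y.prod Z).X m)).map ((prodSnd Y Z).app m) = ⊤ :=
      AddSubgroup.map_top_of_surjective _ fun b => ⟨((0, b) : Y.X m × Z.X m), rfl⟩
    have h₁ : (genBy (Y.prod Z) m (m + 1) h ⊤ (x :: l)).map ((prodSnd Y Z).app (m + 1)) =
        ((Cx.mulX ((koszul M l).X l.length) x (m + 1)).range ⊔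
          (koszul M l).bdry l.length (m + 1 + 1) :
            AddSubgroup (((koszul M l).X l.length).X (m + 1 + 1))) := by
      rw [genBy_map, htop, ih (m + 1) (m + 1 + 1) (by push_cast; ring),
        AddMonoidHom.range_eq_map]
      exact genBy_shift _ 1 m (m + 1) h (by push_cast; ring) ⊤ (x :: l)
    ext c
    refine (Cx.mem_bdry_cone_succ (koszul M l) x l.length (m + 1) (hs _) c).trans ?_
    exact (SetLike.ext_iff.1 h₁ _).symm.trans (AddSubgroup.mem_map_iff_mem hinj)

/-- The identification of the last term of the Koszul complex. -/
def koszulTop : ∀ l : List (𝒜 1), M.shift l.length ⟶ (koszul M l).X l.length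
  | [] =>
    { app := fun n => M.tr (n + ((0 : ℕ) : ℤ)) n (by simp)
      comm := fun m n k h r y => (M.act_tr m _ _ _ h r y).symm }
  | x :: l =>
    { app := fun n => (AddMonoidHom.inr (((koszul M l).X (l.length + 1)).X n)
        (((koszul M l).X l.length).X (n + 1))).comp (((koszulTop l).app (n + 1)).comp
          (M.tr (n + ((l.length + 1 : ℕ) : ℤ)) (n + 1 + l.length) (by push_cast; ring)))
      comm := fun m n k h r y => Prod.ext
        (map_zero (((koszul M l).X (l.length + 1)).act m n k h r)).symm
        ((congrArg ((koszulTop l).app (k + 1)) (M.act_tr m _ _ _ (by omega) r y).symm).trans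
          ((koszulTop l).comm m (n + 1) (k + 1) (by omega) r _)) }

lemma tr_bijective (n k : ℤ) (h : n = k) : Function.Bijective (M.tr n k h) := by
  subst h
  exact ⟨fun x y hxy => by simpa using hxy, fun x => ⟨x, by simp⟩⟩

lemma koszulTop_bijective (l : List (𝒜 1)) (n : ℤ) :
    Function.Bijective ((koszulTop M l).app n) := by
  induction l generalizing n with
  | nil => exact M.tr_bijective (n + ((0 : ℕ) : ℤ)) n (by simp)
  | cons x l ih =>
    have hb := (ih (n + 1)).comp (M.tr_bijective (n + ((l.length + 1 : ℕ) : ℤ))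
      (n + 1 + l.length) (by push_cast; ring))
    refine ⟨fun a b hab => hb.1 (congrArg Prod.snd hab), ?_⟩
    rintro ⟨a, b⟩
    obtain ⟨c, hc⟩ := hb.2 b
    exact ⟨c, Prod.ext (@Subsingleton.elim _
      (subsingleton_koszul_X M l (l.length + 1) (by simp) n) _ _) hc⟩

end koszul
end GrMod

namespace GrMod

variable {R : Type u} [CommRing R] {𝒜 : ℕ → AddSubgroup R} [GradedRing 𝒜]

/-! ### Propagation of vanishing -/

/-- An isomorphism of graded modules from a homomorphism that is bijective in every degree. -/
def isoOfBijective {X Y : GrMod 𝒜} (f : X ⟶ Y) (hf : ∀ n, Function.Bijective (f.app n)) :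
    X ≅ Y where
  hom := f
  inv := liftOfInjective f (fun n => (hf n).1) (𝟙 Y) fun n y => (hf n).2 y
  hom_inv_id := by
    ext n x
    exact (hf n).1 ((hf n).2 (f.app n x)).choose_spec
  inv_hom_id := by
    ext n y
    exact ((hf n).2 y).choose_spec

lemma subsingleton_localCohomology_of_koszul (X : GrMod 𝒜) (l : List (𝒜 1)) (i : ℕ) (n : ℤ)
    (h : Subsingleton ((localCohomology i ((koszul X l).X l.length)).X n)) :
    Subsingleton ((localCohomology i X).X (n + l.length)) :=
  subsingleton_shift_iff.1 (subsingleton_of_iso (((Γ 𝒜).rightDerived i).mapIso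
    (isoOfBijective (koszulTop X l) (koszulTop_bijective X l)).symm) h)

/-- The component of degree `k` is generated by the component of degree `k - 1` and the elements of
degree one in `l`. -/
def GeneratedIn (X : GrMod 𝒜) (l : List (𝒜 1)) (k : ℤ) : Prop :=
  genBy X (k - 1) k (by push_cast; ring) ⊤ l = ⊤

lemma generatedIn_iff {X : GrMod 𝒜} {l : List (𝒜 1)} {m k : ℤ} (h : ((1 : ℕ) : ℤ) + m = k) :
    X.GeneratedIn l k ↔ genBy X m k h ⊤ l = ⊤ := by
  obtain rfl : m = k - 1 := by push_cast at h; omega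
  exact Iff.rfl

/-- The last cokernel is the quotient of `X` by the multiples of `l`, shifted by the length of `l`.
This is how generator degrees enter the cohomological argument. -/
lemma subsingleton_koszul_D_iff (X : GrMod 𝒜) (l : List (𝒜 1)) (n : ℤ) :
    Subsingleton (((koszul X l).D l.length).X n) ↔ X.GeneratedIn l (n + l.length) := by
  have h₁ : (koszul X l).bdry l.length n =
      (genBy X (n - 1 + l.length) (n + l.length) (by push_cast; ring) ⊤ l).map
        ((koszulTop X l).app n) := by
    rw [koszul_bdry_length X l (n - 1) n (by push_cast; ring),
      ← AddSubgroup.map_top_of_surjective _ (koszulTop_bijective X l (n - 1)).2, ← genBy_map]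
    congr 1
    exact genBy_shift X l.length (n - 1) n _ _ ⊤ l
  have h₂ : Subsingleton (((koszul X l).D l.length).X n) ↔ (koszul X l).bdry l.length n = ⊤ :=
    QuotientAddGroup.subsingleton_iff
  rw [h₂, h₁, generatedIn_iff (m := n - 1 + l.length) (by push_cast; ring)]
  constructor
  · intro h
    refine AddSubgroup.map_injective (koszulTop_bijective X l n).1 (h.trans ?_)
    exact (AddSubgroup.map_top_of_surjective _ (koszulTop_bijective X l n).2).symm
  · intro h
    rw [h]
    exact AddSubgroup.map_top_of_surjective _ (koszulTop_bijective X l n).2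

section

variable {X : GrMod 𝒜} {l : List (𝒜 1)} (hX : EventuallyGenerated l X)
include hX

lemma EventuallyGenerated.isBoundedAbove_D : ((koszul X l).D l.length).IsBoundedAbove := by
  obtain ⟨m₀, hm₀⟩ := hX (fun _ => ⊤) fun _ _ _ _ _ _ _ => trivial
  refine ⟨m₀ - l.length + 1, fun n hn => (subsingleton_koszul_D_iff X l n).2 ?_⟩
  exact top_le_iff.1 (hm₀ _ _ _ (by omega))

/-- If the local cohomology vanishes in all pairs `(i, n)` with `i + n = w`, then it vanishes in all
pairs with `i + n = w + 1`, provided that the module has no new generators in degree `w + 1`. -/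
lemma EventuallyGenerated.subsingleton_succ (w : ℤ)
    (h : ∀ (i : ℕ) (n : ℤ), (i : ℤ) + n = w → Subsingleton ((localCohomology i X).X n))
    (hg : X.GeneratedIn l (w + 1)) (i : ℕ) (n : ℤ) (hw : (i : ℤ) + n = w + 1) :
    Subsingleton ((localCohomology i X).X n) := by
  -- The last term of the Koszul complex is `X` shifted by the length of `l`; there the obstruction
  -- `D` to passing to the next line is precisely the set of new generators in degree `w + 1`.
  have := subsingleton_localCohomology_of_koszul X l i (n - l.length)
    (Cx.subsingleton_of_line (exists_cohomologyBoundedBy X l hX) w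
      (fun i p n hn => subsingleton_localCohomology_koszul X l i p n (h i _ (by omega)))
      l.length hX.isBoundedAbove_D
      (fun n hn => (subsingleton_koszul_D_iff X l n).2
        (by rwa [show n + (l.length : ℤ) = w + 1 by omega])) i (n - l.length) (by omega))
  rwa [sub_add_cancel] at this

lemma EventuallyGenerated.generatedIn (w : ℤ)
    (h : ∀ (i : ℕ) (n : ℤ), (i : ℤ) + n = w → Subsingleton ((localCohomology i X).X n)) :
    X.GeneratedIn l w := by
  have := (subsingleton_koszul_D_iff X l (w - l.length)).1
    (Cx.subsingleton_D (exists_cohomologyBoundedBy X l hX) w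
      (fun i p n hn => subsingleton_localCohomology_koszul X l i p n (h i _ (by omega)))
      l.length hX.isBoundedAbove_D (w - l.length) (by omega))
  rwa [sub_add_cancel] at this

/-- The bound on `i + n` is uniform in `i`, so the regularity is less than `+∞` without a separate
vanishing result for large `i`. -/
lemma EventuallyGenerated.exists_subsingleton :
    ∃ t : ℤ, ∀ (i : ℕ) (n : ℤ), t < i + n → Subsingleton ((localCohomology i X).X n) := by
  obtain ⟨t, ht⟩ := exists_cohomologyBoundedBy_uniform X l hX
  refine ⟨t, fun i n hn => ?_⟩
  have h₀ := koszul_X_zero X l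
  have := Cx.subsingleton_initial t ht (fun i p n h =>
    subsingleton_localCohomology_koszul X l i p n (h₀ ▸ h)) l
    (lcMap_koszul_d_eq_zero X l) i n hn
  exact h₀ ▸ this

/-- The climb starts on the line `t + 1`, which is weak regularity, and goes up one line at a time.
-/
lemma EventuallyGenerated.isRegular (t : ℤ) (ht : X.IsWeaklyRegular t)
    (hg : ∀ k, t < k → X.GeneratedIn l k) : X.IsRegular t := by
  have key : ∀ (w : ℤ), t + 1 ≤ w → ∀ (i : ℕ) (n : ℤ), (i : ℤ) + n = w →
      Subsingleton ((localCohomology i X).X n) := by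
    intro w hw
    induction w, hw using Int.leInduction with
    | base =>
      intro i n hn
      have := ht i
      rwa [show t - i + 1 = n by omega] at this
    | succ w hw ih => exact hX.subsingleton_succ w ih (hg _ (by omega))
  exact fun i n hn => key (n + 1) (by omega) i _ (by omega)

lemma EventuallyGenerated.generatedIn_of_isRegular {t : ℤ} (ht : X.IsRegular t) (k : ℤ)
    (hk : t < k) : X.GeneratedIn l k :=
  hX.generatedIn k fun i n hn => by
    have := ht i (k - 1) (by omega)
    rwa [show k - 1 - i + 1 = n by omega] at this

lemma EventuallyGenerated.exists_isRegular : ∃ t, X.IsRegular t := by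
  obtain ⟨t, ht⟩ := hX.exists_subsingleton
  exact ⟨t, fun i n hn => ht i _ (by omega)⟩

end

/-! ### Regularity -/

lemma add_coe_le_coe_iff {a : WithBot (WithTop ℤ)} {i t : ℤ} :
    a + ((i : WithTop ℤ) : WithBot (WithTop ℤ)) ≤ ((t : WithTop ℤ) : WithBot (WithTop ℤ)) ↔
      a ≤ (((t - i : ℤ) : WithTop ℤ) : WithBot (WithTop ℤ)) := by
  induction a using WithBot.recBotCoe with
  | bot => simp
  | coe a =>
    rw [← WithBot.coe_add, WithBot.coe_le_coe, WithBot.coe_le_coe]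
    induction a using WithTop.recTopCoe with
    | top => simp
    | coe a =>
      rw [← WithTop.coe_add, WithTop.coe_le_coe, WithTop.coe_le_coe]
      omega

lemma isRegular_iff_reg_le {X : GrMod 𝒜} {t : ℤ} :
    X.IsRegular t ↔ X.reg ≤ ((t : WithTop ℤ) : WithBot (WithTop ℤ)) := by
  simp only [reg, iSup_le_iff, add_coe_le_coe_iff, aInv, sSup_le_iff]
  constructor
  · rintro h i _ ⟨n, hn, rfl⟩
    rw [WithBot.coe_le_coe, WithTop.coe_le_coe]
    by_contra! hlt
    have := h i (n + i - 1) (by omega)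
    rw [show n + i - 1 - (i : ℤ) + 1 = n by ring] at this
    exact not_subsingleton _ this
  · intro h i n hn
    rw [← not_nontrivial_iff_subsingleton]
    intro hnt
    have := h i _ ⟨_, hnt, rfl⟩
    rw [WithBot.coe_le_coe, WithTop.coe_le_coe] at this
    omega

/-- The failure of regularity at `r - 1` also excludes the value `-∞`. -/
lemma reg_eq {X : GrMod 𝒜} {r : ℤ} (h : X.IsRegular r) (h' : ¬ X.IsRegular (r - 1)) :
    X.reg = ((r : WithTop ℤ) : WithBot (WithTop ℤ)) := by
  rw [isRegular_iff_reg_le] at h h'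
  refine le_antisymm h ?_
  induction hx : X.reg using WithBot.recBotCoe with
  | bot => simp [hx] at h'
  | coe a =>
    rw [hx] at h h'
    induction a using WithTop.recTopCoe with
    | top => exact WithBot.coe_le_coe.2 le_top
    | coe a =>
      norm_cast at h h' ⊢
      omega
end GrMod

/-! ### Homogeneous generators -/

section graded

variable {R : Type u} [CommRing R] {𝒜 : ℕ → AddSubgroup R} [GradedRing 𝒜]

/-- Induction over the elements of a span, with homogeneous coefficients. -/
lemma span_induction_of_homogeneous (𝒜 : ℕ → AddSubgroup R) [GradedRing 𝒜] {M : Type u}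
    [AddCommGroup M] [Module R M] {S : Set M} {p : M → Prop} (zero : p 0)
    (add : ∀ x y, p x → p y → p (x + y))
    (smul : ∀ (j : ℕ) (r : 𝒜 j), ∀ z ∈ S, p ((r : R) • z)) {y : M}
    (hy : y ∈ Submodule.span R S) : p y := by
  induction hy using Submodule.closure_induction with
  | zero => exact zero
  | add x y _ _ hx hy => exact add x y hx hy
  | smul_mem r z hz =>
    induction r using DirectSum.Decomposition.inductionOn 𝒜 with
    | zero => rwa [zero_smul]
    | homogeneous r => exact smul _ r z hz
    | add r s hr hs =>
      rw [add_smul]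
      exact add _ _ hr hs

/-- The elements of degree one in the list `l` generate the homogeneous elements of positive degree
of `R`. -/
def GeneratesIrrelevant (l : List (𝒜 1)) : Prop :=
  ∀ (d : ℕ) (r : 𝒜 (1 + d)), r ∈ AddSubgroup.closure
    {y : 𝒜 (1 + d) | ∃ x ∈ l, ∃ s : 𝒜 d, y = ⟨(x : R) * s, SetLike.GradedMul.mul_mem x.2 s.2⟩}

lemma exists_sub_mem_span (hstd : Algebra.adjoin (𝒜 0) (𝒜 1 : Set R) = ⊤) (r : R) :
    ∃ a ∈ 𝒜 0, r - a ∈ Ideal.span (𝒜 1 : Set R) := by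
  have hr : r ∈ Algebra.adjoin (𝒜 0) (𝒜 1 : Set R) := hstd ▸ Algebra.mem_top
  induction hr using Algebra.adjoin_induction with
  | mem x hx => exact ⟨0, zero_mem _, by simpa using Ideal.subset_span hx⟩
  | algebraMap a => exact ⟨a, a.2, by simp [show algebraMap (𝒜 0) R a = a from rfl]⟩
  | add x y _ _ hx hy =>
    obtain ⟨a, ha, hxa⟩ := hx
    obtain ⟨b, hb, hyb⟩ := hy
    exact ⟨a + b, add_mem ha hb, by rw [add_sub_add_comm]; exact add_mem hxa hyb⟩
  | mul x y _ _ hx hy =>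
    obtain ⟨a, ha, hxa⟩ := hx
    obtain ⟨b, hb, hyb⟩ := hy
    refine ⟨a * b, by simpa using SetLike.GradedMul.mul_mem ha hb, ?_⟩
    rw [show x * y - a * b = x * (y - b) + b * (x - a) by ring]
    exact add_mem (Ideal.mul_mem_left _ _ hyb) (Ideal.mul_mem_left _ _ hxa)

/-- Every `r` is congruent to an element of `R_0` modulo the ideal generated by `R_1`, and finitely
many elements of `R_1` generate this ideal. Taking the component of degree `1 + d` removes the part
in `R_0` and makes the coefficients homogeneous of degree `d`. -/
lemma exists_generatesIrrelevant [IsNoetherianRing R]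
    (hstd : Algebra.adjoin (𝒜 0) (𝒜 1 : Set R) = ⊤) :
    ∃ l : List (𝒜 1), GeneratesIrrelevant l := by
  obtain ⟨s, hs, hspan⟩ := (Submodule.fg_span_iff_fg_span_finset_subset (R := R) (𝒜 1 : Set R)).1
    (IsNoetherian.noetherian _)
  refine ⟨s.attach.toList.map fun z => ⟨z.1, hs z.2⟩, fun d r => ?_⟩
  obtain ⟨a, ha, hra⟩ := exists_sub_mem_span hstd (r : R)
  have h₁ : (r : R) - a ∈ Submodule.span R (s : Set R) := hspan ▸ hra
  have h₂ : DirectSum.decompose 𝒜 ((r : R) - a) (1 + d) = r := by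
    rw [DirectSum.decompose_sub, DirectSum.sub_apply, DirectSum.decompose_coe,
      DirectSum.of_eq_same, sub_eq_self]
    exact Subtype.ext (DirectSum.decompose_of_mem_ne 𝒜 ha (by omega))
  rw [← h₂]
  refine span_induction_of_homogeneous 𝒜 (p := fun y => DirectSum.decompose 𝒜 y (1 + d) ∈
    AddSubgroup.closure _) ?_ ?_ ?_ h₁
  · rw [DirectSum.decompose_zero]
    exact zero_mem _
  · intro x y hx hy
    rw [DirectSum.decompose_add]
    exact add_mem hx hy
  · intro j t z hz
    by_cases hj : j = d
    · subst hj
      refine AddSubgroup.subset_closure ⟨⟨z, hs hz⟩, by simpa using hz, t, Subtype.ext ?_⟩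
      refine (DirectSum.decompose_of_mem_same 𝒜 ?_).trans (mul_comm _ _)
      rw [smul_eq_mul, mul_comm]
      exact SetLike.GradedMul.mul_mem (hs hz) t.2
    · rw [show DirectSum.decompose 𝒜 ((t : R) • z) (1 + d) = 0 from Subtype.ext
        (DirectSum.decompose_of_mem_ne 𝒜 (SetLike.GradedMul.mul_mem t.2 (hs hz)) (by omega))]
      exact zero_mem _

lemma GeneratesIrrelevant.act_mem_genBy {l : List (𝒜 1)} (hl : GeneratesIrrelevant l)
    {X : GrMod 𝒜} {N : ∀ n, AddSubgroup (X.X n)} (hN : X.IsSub N) {m k : ℤ}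
    (h : ((1 : ℕ) : ℤ) + m = k) {j : ℕ} (hj : j ≠ 0) {n : ℤ} (h' : (j : ℤ) + n = k) (r : 𝒜 j)
    {z : X.X n} (hz : z ∈ N n) : X.act j n k h' r z ∈ GrMod.genBy X m k h (N m) l := by
  obtain ⟨d, rfl⟩ : ∃ d, j = 1 + d := ⟨j - 1, by omega⟩
  induction hl d r using AddSubgroup.closure_induction with
  | mem r hr =>
    obtain ⟨x, hx, s, rfl⟩ := hr
    rw [X.mul_act 1 d n m k (by push_cast at h h'; omega) h]
    exact GrMod.act_mem_genBy hx (hN d n m _ s z hz)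
  | zero =>
    rw [map_zero]
    exact zero_mem _
  | add r s _ _ hr hs =>
    rw [map_add]
    exact add_mem hr hs
  | neg r _ hr =>
    rw [map_neg]
    exact neg_mem hr

end graded

/-! ### Internal gradings: Noetherianity and degrees of generators -/

namespace IsModuleGrading

variable {R : Type u} [CommRing R] {𝒜 : ℕ → AddSubgroup R} [GradedRing 𝒜]
    {M : Type u} [AddCommGroup M] [Module R M] {ℳ : ℤ → AddSubgroup M}
    (hℳ : IsModuleGrading 𝒜 ℳ)

include hℳ

/-- The homogeneous component of degree `k` of an element. -/
def proj (k : ℤ) : M →+ ℳ k :=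
  letI := hℳ.isInternal.chooseDecomposition
  (DFinsupp.evalAddMonoidHom k).comp (DirectSum.decomposeAddEquiv ℳ).toAddMonoidHom

omit [GradedRing 𝒜] in
lemma coe_proj_of_mem {k : ℤ} {x : M} (hx : x ∈ ℳ k) : (hℳ.proj k x : M) = x :=
  letI := hℳ.isInternal.chooseDecomposition
  DirectSum.decompose_of_mem_same ℳ hx

omit [GradedRing 𝒜] in
lemma proj_of_mem_ne {n k : ℤ} {x : M} (hx : x ∈ ℳ n) (h : n ≠ k) : hℳ.proj k x = 0 :=
  letI := hℳ.isInternal.chooseDecomposition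
  Subtype.ext (DirectSum.decompose_of_mem_ne ℳ hx h)

omit [GradedRing 𝒜] in
lemma mem_closure_homogeneous (x : M) : x ∈ AddSubgroup.closure (⋃ n, (ℳ n : Set M)) := by
  have := hℳ.isInternal.chooseDecomposition
  induction x using DirectSum.Decomposition.inductionOn ℳ with
  | zero => exact zero_mem _
  | homogeneous x => exact AddSubgroup.subset_closure (Set.mem_iUnion.2 ⟨_, x.2⟩)
  | add x y hx hy => exact add_mem hx hy

/-- The components of the elements of a submodule generated by homogeneous elements lie in a given
family of subgroups if this holds for the homogeneous multiples of the generators. -/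
lemma proj_mem_of_mem_span {S : Set M} (hS : ∀ z ∈ S, ∃ n, z ∈ ℳ n) {k : ℤ}
    {P : AddSubgroup (ℳ k)}
    (h : ∀ (j : ℕ) (n : ℤ) (hk : (j : ℤ) + n = k) (r : 𝒜 j) (z : ℳ n), (z : M) ∈ S →
      hℳ.toGrMod.act j n k hk r z ∈ P) {y : M} (hy : y ∈ Submodule.span R S) :
    hℳ.proj k y ∈ P := by
  refine span_induction_of_homogeneous 𝒜 (p := fun y => hℳ.proj k y ∈ P) ?_ ?_ ?_ hy
  · rw [map_zero]
    exact zero_mem _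
  · intro x y hx hy
    rw [map_add]
    exact add_mem hx hy
  · intro j r z hz
    obtain ⟨n, hn⟩ := hS z hz
    have hrz := hℳ.smul_mem j n r z r.2 hn
    by_cases hk : (j : ℤ) + n = k
    · subst hk
      have := h j n rfl r ⟨z, hn⟩ hz
      rwa [show hℳ.proj (j + n) ((r : R) • z) = hℳ.toGrMod.act j n (j + n) rfl r ⟨z, hn⟩ from
        Subtype.ext (hℳ.coe_proj_of_mem hrz)]
    · rw [hℳ.proj_of_mem_ne hrz hk]
      exact zero_mem _

omit [GradedRing 𝒜] in
lemma eq_zero_of_mem_of_ne {n k : ℤ} {x : M} (hn : x ∈ ℳ n) (hk : x ∈ ℳ k) (h : n ≠ k) :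
    x = 0 := by
  rw [← hℳ.coe_proj_of_mem hk, hℳ.proj_of_mem_ne hn h]
  rfl

lemma eventuallyGenerated [IsNoetherian R M] {l : List (𝒜 1)} (hl : GeneratesIrrelevant l) :
    GrMod.EventuallyGenerated l hℳ.toGrMod := by
  intro N hN
  -- The submodules spanned by the elements of `N` of degree at most `a` form an ascending chain.
  -- Beyond the point where it stabilizes, elements of `N` are combinations of elements of lower
  -- degree, with coefficients in `R_+`.
  let S : ℕ → Set M := fun a => {z | ∃ n : ℤ, n ≤ a ∧ ∃ h : z ∈ ℳ n, (⟨z, h⟩ : ℳ n) ∈ N n}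
  have hS : Monotone S := fun a b hab z ⟨n, hn, hz⟩ => ⟨n, hn.trans (by exact_mod_cast hab), hz⟩
  obtain ⟨a, ha⟩ := monotone_stabilizes_iff_noetherian.2 ‹IsNoetherian R M›
    ⟨fun a => Submodule.span R (S a), fun a b hab => Submodule.span_mono (hS hab)⟩
  refine ⟨a, fun m k h hm x hx => ?_⟩
  obtain ⟨x, hxk⟩ := x
  have h₁ : x ∈ Submodule.span R (S k.toNat) :=
    Submodule.subset_span ⟨k, Int.self_le_toNat k, hxk, hx⟩
  have h₂ : x ∈ Submodule.span R (S a) := by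
    have := ha k.toNat (by push_cast at h; omega)
    exact (SetLike.ext_iff.1 this _).2 h₁
  have h₃ : hℳ.proj k x ∈ hℳ.toGrMod.genBy m k h (N m) l := by
    refine hℳ.proj_mem_of_mem_span (S := S a) (fun z ⟨n, _, hz, _⟩ => ⟨n, hz⟩) ?_ h₂
    rintro j n hk r ⟨z, hz⟩ ⟨n', hn', hz', hzN⟩
    by_cases hn : n = n'
    · subst hn
      exact hl.act_mem_genBy hN h (by push_cast at h; omega) hk r hzN
    · obtain rfl := hℳ.eq_zero_of_mem_of_ne hz hz' hn
      rw [show (⟨0, hz⟩ : ℳ n) = (0 : hℳ.toGrMod.X n) from rfl, map_zero]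
      exact zero_mem _
  rwa [show hℳ.proj k x = ⟨x, hxk⟩ from Subtype.ext (hℳ.coe_proj_of_mem hxk)] at h₃

omit [GradedRing 𝒜] in
lemma exists_isMinimalHomogeneousGenerators [Module.Finite R M] :
    ∃ S : Set M, IsMinimalHomogeneousGenerators R ℳ S := by
  classical
  have h₁ : Submodule.span R {x : M | ∃ n, x ∈ ℳ n} = ⊤ := by
    refine eq_top_iff.2 fun x _ => ?_
    have h := (AddSubgroup.closure_le (K := (Submodule.span R {x : M | ∃ n, x ∈ ℳ n}).toAddSubgroup)).2
      (fun x hx => Submodule.subset_span (Set.mem_iUnion.1 hx))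
    exact h (hℳ.mem_closure_homogeneous x)
  obtain ⟨F, hF, hspan⟩ := (Submodule.fg_span_iff_fg_span_finset_subset
    (R := R) {x : M | ∃ n, x ∈ ℳ n}).1 (h₁ ▸ Module.Finite.fg_top)
  obtain ⟨S, hS⟩ := exists_minimal_of_wellFoundedLT
    (fun S : Finset M => (∀ x ∈ S, ∃ n, x ∈ ℳ n) ∧ Submodule.span R (S : Set M) = ⊤)
    ⟨F, fun x hx => hF hx, hspan.symm.trans h₁⟩
  refine ⟨S, fun x hx => hS.prop.1 x hx, hS.prop.2, fun x hx h => ?_⟩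
  have := hS.le_of_le (y := S.erase x)
    ⟨fun y hy => hS.prop.1 y (Finset.mem_of_mem_erase hy), by rwa [Finset.coe_erase]⟩
    (Finset.erase_subset x S)
  exact Finset.notMem_erase x S (this hx)

/-- Both implications expand elements in a minimal set `S` and take homogeneous components. If all
of `S` has degree at most `t`, a component of degree `k > t` involves only coefficients of positive
degree. Conversely, a generator `x ∈ S` of degree `n > t` would be redundant, since `M_n` is
generated from `M_{n-1}`, whose elements need only `S \ {x}`. -/
lemma maxGeneratorDegree_le_iff [Module.Finite R M] {l : List (𝒜 1)} (hl : GeneratesIrrelevant l)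
    {t : ℤ} : maxGeneratorDegree R ℳ ≤ ((t : WithTop ℤ) : WithBot (WithTop ℤ)) ↔
      ∀ k, t < k → hℳ.toGrMod.GeneratedIn l k := by
  constructor
  · intro h k hk
    obtain ⟨S, hS⟩ := hℳ.exists_isMinimalHomogeneousGenerators
    refine eq_top_iff.2 fun y _ => ?_
    obtain ⟨y, hy⟩ := y
    have hmem : hℳ.proj k y ∈ hℳ.toGrMod.genBy (k - 1) k (by push_cast; ring) ⊤ l := by
      refine hℳ.proj_mem_of_mem_span hS.homogeneous ?_
        (hS.span_eq_top ▸ Submodule.mem_top : y ∈ Submodule.span R S)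
      rintro j n hjk r ⟨z, hz⟩ hzS
      have hn := h.trans' (le_sSup ⟨S, z, n, hS, hzS, hz, rfl⟩)
      rw [WithBot.coe_le_coe, WithTop.coe_le_coe] at hn
      exact hl.act_mem_genBy (N := fun _ => ⊤) (fun _ _ _ _ _ _ _ => trivial) _ (by omega) hjk r
        trivial
    rwa [show hℳ.proj k y = ⟨y, hy⟩ from Subtype.ext (hℳ.coe_proj_of_mem hy)] at hmem
  · rintro h
    refine sSup_le ?_
    rintro _ ⟨S, x, n, hS, hxS, hxn, rfl⟩
    rw [WithBot.coe_le_coe, WithTop.coe_le_coe]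
    by_contra! hlt
    have h₁ : ∀ y ∈ ℳ (n - 1), y ∈ Submodule.span R (S \ {x}) := by
      intro y hy
      rw [← hℳ.coe_proj_of_mem hy]
      refine hℳ.proj_mem_of_mem_span (P := (Submodule.span R (S \ {x})).toAddSubgroup.comap
        (ℳ (n - 1)).subtype) hS.homogeneous ?_ (hS.span_eq_top ▸ Submodule.mem_top)
      rintro j m hjm r ⟨z, hz⟩ hzS
      change (r : R) • z ∈ Submodule.span R (S \ {x})
      refine Submodule.smul_mem _ _ ?_
      -- A generator that contributes to degree `n - 1` has degree at most `n - 1`. It can coincide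
      -- with `x`, of degree `n`, only if it is zero.
      by_cases hzx : z = x
      · subst hzx
        rw [hℳ.eq_zero_of_mem_of_ne hz hxn (by omega)]
        exact zero_mem _
      · exact Submodule.subset_span ⟨hzS, hzx⟩
    have h₂ : x ∈ Submodule.span R (S \ {x}) := by
      have hx : (⟨x, hxn⟩ : hℳ.toGrMod.X n) ∈
          hℳ.toGrMod.genBy (n - 1) n (by push_cast; ring) ⊤ l :=
        (h n hlt).symm ▸ AddSubgroup.mem_top _
      refine GrMod.genBy_le_of_forall (N' := (Submodule.span R (S \ {x})).toAddSubgroup.comap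
        (ℳ n).subtype) ?_ hx
      rintro r _ ⟨y, hy⟩ _
      exact Submodule.smul_mem _ (r : R) (h₁ y hy)
    refine hS.minimal x hxS (top_le_iff.1 (hS.span_eq_top.ge.trans (Submodule.span_le.2 ?_)))
    intro z hz
    by_cases hzx : z = x
    · rwa [hzx]
    · exact Submodule.subset_span ⟨hz, hzx⟩

omit [GradedRing 𝒜] in
lemma exists_le_maxGeneratorDegree [Module.Finite R M] [Nontrivial M] :
    ∃ k : ℤ, ((k : WithTop ℤ) : WithBot (WithTop ℤ)) ≤ maxGeneratorDegree R ℳ := by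
  obtain ⟨S, hS⟩ := hℳ.exists_isMinimalHomogeneousGenerators
  obtain ⟨x, hx⟩ : S.Nonempty := by
    rw [Set.nonempty_iff_ne_empty]
    rintro rfl
    have := hS.span_eq_top
    rw [Submodule.span_empty] at this
    exact bot_ne_top this
  obtain ⟨n, hn⟩ := hS.homogeneous x hx
  exact ⟨n, le_sSup ⟨S, x, n, hS, hx, hn, rfl⟩⟩

end IsModuleGrading

end

theorem theorem3p1 {R : Type u} [CommRing R] (𝒜 : ℕ → AddSubgroup R) [GradedRing 𝒜]
    [IsNoetherianRing (𝒜 0)] [Algebra.FiniteType (𝒜 0) R]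
    (hstd : Algebra.adjoin (𝒜 0) (𝒜 1 : Set R) = ⊤)
    {M : Type u} [AddCommGroup M] [Module R M] [Module.Finite R M]
    (ℳ : ℤ → AddSubgroup M) (hℳ : IsModuleGrading 𝒜 ℳ) :
    (∀ t : ℤ, maxGeneratorDegree R ℳ ≤ ((t : WithTop ℤ) : WithBot (WithTop ℤ)) →
      hℳ.toGrMod.IsWeaklyRegular t → hℳ.toGrMod.IsRegular t) ∧
    (Nontrivial M → ∃ r : ℤ,
      hℳ.toGrMod.reg = ((r : WithTop ℤ) : WithBot (WithTop ℤ)) ∧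
      IsLeast {t : ℤ | maxGeneratorDegree R ℳ ≤ ((t : WithTop ℤ) : WithBot (WithTop ℤ)) ∧
        hℳ.toGrMod.IsWeaklyRegular t} r) := by
  have : IsNoetherianRing R := Algebra.FiniteType.isNoetherianRing (𝒜 0) R
  obtain ⟨l, hl⟩ := exists_generatesIrrelevant hstd
  have hX := hℳ.eventuallyGenerated hl
  have hd := fun t : ℤ => hℳ.maxGeneratorDegree_le_iff hl (t := t)
  have ha : ∀ t : ℤ, maxGeneratorDegree R ℳ ≤ ((t : WithTop ℤ) : WithBot (WithTop ℤ)) →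
      hℳ.toGrMod.IsWeaklyRegular t → hℳ.toGrMod.IsRegular t :=
    fun t ht hw => hX.isRegular t hw ((hd t).1 ht)
  have hb : ∀ t : ℤ, hℳ.toGrMod.IsRegular t →
      t ∈ {t : ℤ | maxGeneratorDegree R ℳ ≤ ((t : WithTop ℤ) : WithBot (WithTop ℤ)) ∧
        hℳ.toGrMod.IsWeaklyRegular t} :=
    fun t ht => ⟨(hd t).2 (hX.generatedIn_of_isRegular ht), fun i => ht i t le_rfl⟩
  refine ⟨ha, fun _ => ?_⟩
  obtain ⟨t, ht⟩ := hX.exists_isRegular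
  obtain ⟨k, hk⟩ := hℳ.exists_le_maxGeneratorDegree
  -- A nonzero `M` has a minimal generator of some degree `k`, and every member of the set is at
  -- least `d(M) ≥ k`.
  obtain ⟨r, hr, hmin⟩ := Int.exists_least_of_bdd (P := fun t =>
    maxGeneratorDegree R ℳ ≤ ((t : WithTop ℤ) : WithBot (WithTop ℤ)) ∧
      hℳ.toGrMod.IsWeaklyRegular t)
    ⟨k, fun z hz => WithTop.coe_le_coe.1 (WithBot.coe_le_coe.1 (hk.trans hz.1))⟩ ⟨t, hb t ht⟩
  -- If `M` were `(r - 1)`-regular, then `r - 1` would belong to the set by `hb`, against the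
  -- minimality of `r`.
  refine ⟨r, GrMod.reg_eq (ha r hr.1 hr.2) fun h => ?_, hr, fun z hz => hmin z hz⟩
  have := hmin _ (hb _ h)
  omega
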